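/- Let $\delta>0$ and let $w=(w_n)_{n\in\mathbb Z}$ be a real weight which is a (weakly) increasing function of $|n|$ and satisfies, for all $n\in\mathbb Z$, $$\mathrm{(W)}\qquad 1\le w_n,\qquad |w_{n+1}-w_n|\le d_1w_n,\qquad d_2w_n\le w_{n+1},$$ with real constants $d_1$ and $d_2>0$. Let $\ell^2_w$ be the space of complex sequences $u=(u_n)_{n\in\mathbb Z}$ with norm $\|u\|_{\ell^2_w}^2=\sum_{n\in\mathbb Z}w_n|u_n|^2<\infty$, and let $g=(g_n)_{n\in\mathbb Z}\in\ell^2_w$. Let $F:\mathbb C\to\mathbb C$ satisfy $\mathrm{(N_2)}$: $F(z)=f(|z|^2)z$, where $f:\mathbb R\to\mathbb R$ is differentiable and $f,f'$ are continuous. Assume $$\frac{\delta}{2}-2d_1d_2^{-1/2}\ge 0 .$$ Then the damped driven discrete nonlinear Schrödinger equation $$i\dot u_n+(u_{n-1}-2u_n+u_{n+1})+i\delta u_n+F(u_n)=g_n,\quad n\in\mathbb Z,\qquad u(0)=u_0,$$ has, for every $u_0\in\ell^2_w$, a solution $u\in C^1([0,\infty),\ell^2_w)$, which is the unique solution in $C^1([0,T],\ell^2_w)$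 for every $T>0$, and $S(t)u_0:=u(t)$, $t\ge0$, defines a continuous semigroup on $\ell^2_w$. This semigroup has a bounded absorbing set, that is, a bounded set $\mathcal B_0\subset\ell^2_w$ such that for each bounded $\mathcal B\subset\ell^2_w$ there is $t_0$ with $S(t)\mathcal B\subset\mathcal B_0$ for all $t\ge t_0$. Moreover $S(t)$ has a global attractor $\mathcal A\subset\ell^2_w$: $\mathcal A$ is compact, $S(t)\mathcal A=\mathcal A$ for all $t\ge0$, and for each bounded $\mathcal B\subset\ell^2_w$, $\sup_{b\in\mathcal B}\operatorname{dist}_{\ell^2_w}(S(t)b,\mathcal A)\to0$ as $t\to\infty$. The set $\mathcal A$ is nonempty and connected; for every bounded absorbing set $\mathcal B_0$ one has $$\mathcal A=\omega(\mathcal B_0):=\bigcap_{s\ge0}\overline{\bigcup_{t\ge s}S(t)\mathcal B_0}\subset\mathcal B_0;$$ and $\mathcal A$ contains every bounded set $Y\subset\ell^2_w$ with $S(t)Y=Y$ for all $t\ge0$. -/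

import Mathlib

open Set Filter Topology
open scoped NNReal

noncomputable section

/-! ### The weighted space of square-summable bi-infinite complex sequences -/

/-- The sequences `u : ℤ → ℂ` with `∑ w_n |u_n|² < ∞`, for a positive weight `w`. -/
def weightedL2Submodule (w : ℤ → {r : ℝ // 0 < r}) : Submodule ℂ (ℤ → ℂ) where
  carrier := {u | Summable fun n => (w n : ℝ) * ‖u n‖ ^ 2}
  zero_mem' := by simp [summable_zero]
  add_mem' := by
    intro a b ha hb
    have h := (ha.mul_left 2).add (hb.mul_left 2)
    refine Summable.of_nonneg_of_le
      (fun n => mul_nonneg (w n).2.le (sq_nonneg _)) (fun n => ?_) h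
    have h1 : ‖(a + b) n‖ ≤ ‖a n‖ + ‖b n‖ := norm_add_le _ _
    have h2 : ‖(a + b) n‖ ^ 2 ≤ 2 * ‖a n‖ ^ 2 + 2 * ‖b n‖ ^ 2 := by
      nlinarith [norm_nonneg ((a + b) n), sq_nonneg (‖a n‖ - ‖b n‖),
        norm_nonneg (a n), norm_nonneg (b n)]
    have h3 := mul_le_mul_of_nonneg_left h2 (w n).2.le
    linarith
  smul_mem' := by
    intro c a ha
    have h := Summable.mul_left (‖c‖ ^ 2) ha
    refine h.congr (fun n => ?_)
    simp only [Pi.smul_apply, smul_eq_mul, norm_mul]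
    ring

/-- The space `ℓ²_w`. It is a separate type, so that it does not inherit the topology of
pointwise convergence from `ℤ → ℂ`; its topology is that of the norm defined below. -/
def WeightedL2 (w : ℤ → {r : ℝ // 0 < r}) : Type := ↥(weightedL2Submodule w)

namespace WeightedL2

variable {w : ℤ → {r : ℝ // 0 < r}}

instance : AddCommGroup (WeightedL2 w) :=
  inferInstanceAs (AddCommGroup ↥(weightedL2Submodule w))

instance : Module ℂ (WeightedL2 w) :=
  inferInstanceAs (Module ℂ ↥(weightedL2Submodule w))

instance : CoeFun (WeightedL2 w) (fun _ => ℤ → ℂ) := ⟨fun u => u.1⟩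

theorem ext {u v : WeightedL2 w} (h : ∀ n, u n = v n) : u = v :=
  Subtype.ext (funext h)

theorem add_apply (u v : WeightedL2 w) (n : ℤ) : (u + v) n = u n + v n := rfl

theorem smul_apply (c : ℂ) (u : WeightedL2 w) (n : ℤ) : (c • u) n = c * u n := rfl

theorem neg_apply (u : WeightedL2 w) (n : ℤ) : (-u) n = -(u n) := rfl

theorem zero_apply (n : ℤ) : (0 : WeightedL2 w) n = 0 := rfl

theorem summable (u : WeightedL2 w) : Summable fun n => (w n : ℝ) * ‖u n‖ ^ 2 := u.2

theorem sqrt_add_le (u v : WeightedL2 w) :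
    √(∑' n, (w n : ℝ) * ‖(u + v) n‖ ^ 2) ≤
      √(∑' n, (w n : ℝ) * ‖u n‖ ^ 2) + √(∑' n, (w n : ℝ) * ‖v n‖ ^ 2) := by
  have key : ∀ x : WeightedL2 w, ∀ n,
      (√(w n : ℝ) * ‖x n‖) ^ (2 : ℝ) = (w n : ℝ) * ‖x n‖ ^ 2 := by
    intro x n
    rw [Real.rpow_two, mul_pow, Real.sq_sqrt (w n).2.le]
  have hs : ∀ x : WeightedL2 w, Summable fun n => (√(w n : ℝ) * ‖x n‖) ^ (2 : ℝ) := by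
    intro x
    simpa only [key] using x.summable
  have h := Real.Lp_add_le_tsum_of_nonneg (p := 2) (by norm_num)
    (fun n => mul_nonneg (Real.sqrt_nonneg (w n : ℝ)) (norm_nonneg (u n)))
    (fun n => mul_nonneg (Real.sqrt_nonneg (w n : ℝ)) (norm_nonneg (v n))) (hs u) (hs v)
  simp only [key] at h
  rw [← Real.sqrt_eq_rpow, ← Real.sqrt_eq_rpow, ← Real.sqrt_eq_rpow] at h
  refine le_trans (Real.sqrt_le_sqrt ?_) h.2
  refine Summable.tsum_le_tsum (fun n => ?_) (u + v).summable h.1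
  rw [← key]
  refine Real.rpow_le_rpow (mul_nonneg (Real.sqrt_nonneg _) (norm_nonneg _)) ?_ (by norm_num)
  rw [← mul_add]
  exact mul_le_mul_of_nonneg_left (norm_add_le _ _) (Real.sqrt_nonneg _)

/-- The norm `‖u‖ = (∑ w_n |u_n|²)^{1/2}`. -/
instance : NormedAddCommGroup (WeightedL2 w) :=
  AddGroupNorm.toNormedAddCommGroup
    { toFun := fun u => √(∑' n, (w n : ℝ) * ‖u n‖ ^ 2)
      map_zero' := by simp [zero_apply]
      add_le' := sqrt_add_le
      neg' := by simp [neg_apply]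
      eq_zero_of_map_eq_zero' := by
        intro u hu
        have hnn : ∀ n, 0 ≤ (w n : ℝ) * ‖u n‖ ^ 2 :=
          fun n => mul_nonneg (w n).2.le (sq_nonneg _)
        have h0 := (Real.sqrt_eq_zero (tsum_nonneg hnn)).1 hu
        have h1 := (hasSum_zero_iff_of_nonneg hnn).1 (h0 ▸ u.summable.hasSum)
        refine ext fun n => ?_
        have h2 := congrFun h1 n
        rw [zero_apply]
        simpa [(w n).2.ne'] using h2 }

theorem norm_def (u : WeightedL2 w) : ‖u‖ = √(∑' n, (w n : ℝ) * ‖u n‖ ^ 2) := rfl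

instance : NormedSpace ℂ (WeightedL2 w) where
  norm_smul_le := by
    intro c u
    rw [norm_def, norm_def]
    have h : ∀ n, (w n : ℝ) * ‖(c • u) n‖ ^ 2 = ‖c‖ ^ 2 * ((w n : ℝ) * ‖u n‖ ^ 2) := by
      intro n
      rw [smul_apply, norm_mul]
      ring
    simp only [h]
    rw [tsum_mul_left, Real.sqrt_mul (sq_nonneg _), Real.sqrt_sq (norm_nonneg _)]

end WeightedL2

/-! ### Hypotheses on the weight and on the nonlinearity -/

/-- `w` is a (weakly) increasing function of `|n|` with `1 ≤ w_n`,
`|w_{n+1} - w_n| ≤ d₁ w_n` and `d₂ w_n ≤ w_{n+1}`, where `d₂ > 0`. -/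
structure WeightCondition (w : ℤ → {r : ℝ // 0 < r}) (d₁ d₂ : ℝ) : Prop where
  mono : ∀ m n : ℤ, |m| ≤ |n| → (w m : ℝ) ≤ w n
  one_le : ∀ n, 1 ≤ (w n : ℝ)
  abs_sub_le : ∀ n, |(w (n + 1) : ℝ) - w n| ≤ d₁ * w n
  le_succ : ∀ n, d₂ * w n ≤ (w (n + 1) : ℝ)
  d₂_pos : 0 < d₂

/-- `F(z) = f(|z|²) z` with `f : ℝ → ℝ` differentiable and `f, f'` continuous. -/
def NonlinearityCondition (F : ℂ → ℂ) : Prop :=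
  ∃ f : ℝ → ℝ, Differentiable ℝ f ∧ Continuous (deriv f) ∧
    ∀ z : ℂ, F z = (f (‖z‖ ^ 2) : ℂ) * z

/-! ### The lattice equation -/

/-- `u ∈ C¹(J, ℓ²_w)` solves
`i u̇_n + (u_{n-1} - 2 u_n + u_{n+1}) + i δ u_n + F(u_n) = g_n`, `n ∈ ℤ`, on the interval `J`
(with one-sided derivatives at the endpoints that belong to `J`). -/
def IsDNLSSolutionOn {w : ℤ → {r : ℝ // 0 < r}} (δ : ℝ) (F : ℂ → ℂ) (g : WeightedL2 w)
    (J : Set ℝ) (u : ℝ → WeightedL2 w) : Prop :=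
  ∃ u' : ℝ → WeightedL2 w, ContinuousOn u' J ∧
    ∀ t ∈ J, HasDerivWithinAt u (u' t) J t ∧
      ∀ n : ℤ, Complex.I * u' t n + (u t (n - 1) - 2 * u t n + u t (n + 1))
        + Complex.I * (δ : ℂ) * u t n + F (u t n) = g n

/-- `S` is the solution semigroup of the lattice equation on `ℓ²_w`: for every initial value
`u₀`, the curve `t ↦ S(t) u₀` is a solution on `[0, ∞)` starting at `u₀`, and it is the only
solution starting at `u₀` on every interval `[0, T]`. The semigroup law and continuity
are part of `Flow`. -/
structure IsDNLSSemigroup {w : ℤ → {r : ℝ // 0 < r}} (δ : ℝ) (F : ℂ → ℂ) (g : WeightedL2 w)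
    (S : Flow ℝ≥0 (WeightedL2 w)) : Prop where
  init : ∀ u₀, S 0 u₀ = u₀
  isSolution : ∀ u₀, IsDNLSSolutionOn δ F g (Ici 0) (fun t => S t.toNNReal u₀)
  unique : ∀ u₀, ∀ T > (0 : ℝ), ∀ v : ℝ → WeightedL2 w,
    IsDNLSSolutionOn δ F g (Icc 0 T) v → v 0 = u₀ → ∀ t ∈ Icc 0 T, v t = S t.toNNReal u₀

/-! ### Absorbing sets and global attractors of a continuous semigroup -/

section Dynamics

variable {X : Type*} [PseudoMetricSpace X]

/-- A bounded set into which every bounded set is mapped for all large times. -/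
structure IsBoundedAbsorbing (S : Flow ℝ≥0 X) (B₀ : Set X) : Prop where
  bounded : Bornology.IsBounded B₀
  absorbs : ∀ B : Set X, Bornology.IsBounded B → ∃ t₀ : ℝ≥0, ∀ t ≥ t₀, MapsTo (S t) B B₀

/-- `S(t) Y = Y` for all `t ≥ 0`. -/
def IsFunctionalInvariant (S : Flow ℝ≥0 X) (Y : Set X) : Prop :=
  ∀ t : ℝ≥0, S t '' Y = Y

/-- A compact functional invariant set that attracts every bounded set uniformly. -/
structure IsGlobalAttractor (S : Flow ℝ≥0 X) (A : Set X) : Prop where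
  compact : IsCompact A
  invariant : IsFunctionalInvariant S A
  attracts : ∀ B : Set X, Bornology.IsBounded B → ∀ η > (0 : ℝ), ∃ t₀ : ℝ≥0, ∀ t ≥ t₀,
    MapsTo (S t) B (Metric.thickening η A)

end Dynamics

end

/-! The equation is an ODE `u̇ = V(u)` in `ℓ²_w`. Since `w ≥ 1`, a bounded set of sequences has
uniformly bounded coordinates, on which `F`, being C¹, is Lipschitz. Shifts are bounded because
neighbouring weights are comparable. So `V` is Lipschitz on bounded sets, and an a priori bound is
all that a global semigroup needs (`exists_flow_of_hasAPrioriBounds`).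

One estimate, `IsDNLSField.two_mul_tsum_inner_le`, carries the rest. Differentiate `y = ∑ χ_n w_n
|u_n|²` along a solution, where `χ` is a cut-off with increments at most `ε`. The nonlinearity drops
out because `f` is real. The coupling is a discrete flux, so after summation by parts only the
increments of `χ w` remain. With `D = d₁ d₂^{-1/2}`, the increments of `w` contribute at most `D y`
to `y'/2`, up to an error of order `ε ‖u‖²`, and `4 D ≤ δ` lets the damping absorb this. What
remains is `y' ≤ -δ y + O(ε ‖u‖²) + (2/δ) ∑ χ_n w_n |g_n|²`.

With `χ = 1`, `ε = 0`, Grönwall gives the a priori bound and an absorbing ball. With `χ = min(1,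
|n|/(m+1))`, `ε = 1/(m+1)`, it gives tails that are small uniformly on bounded sets for large times.
Small tails and coordinatewise compactness give asymptotic compactness
(`IsDNLSField.isAsymptoticallyCompactOn`), so the ω-limit set of the absorbing ball is a global
attractor. The other properties of the attractor are purely dynamical. -/

noncomputable section

/-! ### Global attractors of asymptotically compact semigroups -/

section Attractor

variable {X : Type*} [MetricSpace X] {S : Flow ℝ≥0 X} {A B : Set X}

/-- Every sequence `S(t_k) b_k` with `t_k → ∞` and `b_k ∈ B` has a convergent subsequence. -/
def IsAsymptoticallyCompactOn (S : Flow ℝ≥0 X) (B : Set X) : Prop :=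
  ∀ (t : ℕ → ℝ≥0) (b : ℕ → X), Tendsto t atTop atTop → (∀ k, b k ∈ B) →
    ∃ x, ∃ φ : ℕ → ℕ, StrictMono φ ∧ Tendsto (fun k => S (t (φ k)) (b (φ k))) atTop (𝓝 x)

theorem mem_omegaLimit_of_tendsto {t : ℕ → ℝ≥0} {b : ℕ → X} {x : X}
    (ht : Tendsto t atTop atTop) (hb : ∀ k, b k ∈ B)
    (hx : Tendsto (fun k => S (t k) (b k)) atTop (𝓝 x)) :
    x ∈ omegaLimit atTop (fun t u => S t u) B := by
  rw [mem_omegaLimit_iff_frequently]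
  intro n hn
  refine ht.frequently (Eventually.frequently ?_)
  filter_upwards [hx hn] with k hk
  exact ⟨b k, hb k, hk⟩

theorem exists_dist_lt_of_mem_omegaLimit {x : X}
    (hx : x ∈ omegaLimit atTop (fun t u => S t u) B) {ε : ℝ} (hε : 0 < ε) (T : ℝ≥0) :
    ∃ t ≥ T, ∃ b ∈ B, dist (S t b) x < ε := by
  rw [mem_omegaLimit_iff_frequently] at hx
  obtain ⟨t, ht, b, hb, hd⟩ := frequently_atTop.1 (hx _ (Metric.ball_mem_nhds x hε)) T
  exact ⟨t, ht, b, hb, hd⟩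

theorem exists_seq_tendsto_of_mem_omegaLimit {x : X}
    (hx : x ∈ omegaLimit atTop (fun t u => S t u) B) :
    ∃ (t : ℕ → ℝ≥0) (b : ℕ → X), (∀ k : ℕ, (k : ℝ≥0) ≤ t k) ∧ (∀ k, b k ∈ B) ∧
      Tendsto (fun k => S (t k) (b k)) atTop (𝓝 x) := by
  choose t ht b hb hd using fun k : ℕ =>
    exists_dist_lt_of_mem_omegaLimit hx (Nat.one_div_pos_of_nat (α := ℝ) (n := k)) k
  refine ⟨t, b, ht, hb, tendsto_iff_dist_tendsto_zero.2 ?_⟩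
  exact squeeze_zero (fun _ => dist_nonneg) (fun k => (hd k).le)
    tendsto_one_div_add_atTop_nhds_zero_nat

theorem tendsto_atTop_of_natCast_le {t : ℕ → ℝ≥0} (ht : ∀ k : ℕ, (k : ℝ≥0) ≤ t k) :
    Tendsto t atTop atTop :=
  tendsto_atTop_mono ht tendsto_natCast_atTop_atTop

/-- The `k`-th point of a sequence in the ω-limit set lies within `1/(k+1)` of some `S(t_k) b_k`
with `t_k ≥ k`, so a convergent subsequence of these orbit points carries the original one along. -/
theorem isCompact_omegaLimit (hac : IsAsymptoticallyCompactOn S B) :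
    IsCompact (omegaLimit atTop (fun t u => S t u) B) := by
  rw [isCompact_iff_isSeqCompact]
  intro a ha
  choose t ht b hb hd using fun k : ℕ =>
    exists_dist_lt_of_mem_omegaLimit (ha k) (Nat.one_div_pos_of_nat (α := ℝ) (n := k)) k
  have htt := tendsto_atTop_of_natCast_le ht
  obtain ⟨x, φ, hφ, hx⟩ := hac t b htt hb
  refine ⟨x, mem_omegaLimit_of_tendsto (htt.comp hφ.tendsto_atTop) (fun k => hb (φ k)) hx,
    φ, hφ, ?_⟩
  refine (tendsto_iff_of_dist ?_).1 hx
  exact squeeze_zero (fun _ => dist_nonneg) (fun k => (hd (φ k)).le)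
    (tendsto_one_div_add_atTop_nhds_zero_nat.comp hφ.tendsto_atTop)

theorem isFunctionalInvariant_omegaLimit (hac : IsAsymptoticallyCompactOn S B) :
    IsFunctionalInvariant S (omegaLimit atTop (fun t u => S t u) B) := by
  intro s
  apply Subset.antisymm
  · rintro _ ⟨x, hx, rfl⟩
    obtain ⟨t, b, ht, hb, hlim⟩ := exists_seq_tendsto_of_mem_omegaLimit hx
    have h := ((S.continuous_toFun s).tendsto x).comp hlim
    refine mem_omegaLimit_of_tendsto (t := fun k => s + t k)
      (tendsto_atTop_of_natCast_le fun k => (ht k).trans le_add_self) hb ?_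
    simpa only [S.map_add, Function.comp_def] using h
  · intro x hx
    obtain ⟨t, b, ht, hb, hlim⟩ := exists_seq_tendsto_of_mem_omegaLimit hx
    -- To find a preimage of `x` under `S(s)`, stop each orbit `s` earlier and extract a limit.
    -- Subtraction is truncated, but `s ≤ t k` holds eventually.
    have htt : Tendsto (fun k => t k - s) atTop atTop :=
      tendsto_atTop.2 fun c => by
        filter_upwards [(tendsto_atTop_of_natCast_le ht).eventually_ge_atTop (c + s)] with k hk
        exact le_tsub_of_add_le_right hk
    obtain ⟨y, φ, hφ, hy⟩ := hac _ b htt hb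
    refine ⟨y, mem_omegaLimit_of_tendsto (htt.comp hφ.tendsto_atTop) (fun k => hb (φ k)) hy, ?_⟩
    refine tendsto_nhds_unique (((S.continuous_toFun s).tendsto y).comp hy)
      ((hlim.comp hφ.tendsto_atTop).congr' ?_)
    have hs := (tendsto_atTop_of_natCast_le ht).comp hφ.tendsto_atTop
    filter_upwards [hs.eventually_ge_atTop s] with k hk
    simp only [Function.comp_apply]
    rw [← S.map_add, add_tsub_cancel_of_le (show s ≤ t (φ k) from hk)]

/-- An asymptotically compact semigroup with a bounded absorbing set has a global attractor. -/
theorem IsBoundedAbsorbing.isGlobalAttractor_omegaLimit (hB : IsBoundedAbsorbing S B)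
    (hac : IsAsymptoticallyCompactOn S B) :
    IsGlobalAttractor S (omegaLimit atTop (fun t u => S t u) B) where
  compact := isCompact_omegaLimit hac
  invariant := isFunctionalInvariant_omegaLimit hac
  attracts := by
    intro C hC η hη
    obtain ⟨t₁, ht₁⟩ := hB.absorbs C hC
    suffices h : ∃ t₀ : ℝ≥0, ∀ t ≥ t₀,
        MapsTo (S t) B (Metric.thickening η (omegaLimit atTop (fun t u => S t u) B)) by
      obtain ⟨t₀, ht₀⟩ := h
      refine ⟨t₀ + t₁, fun t ht x hx => ?_⟩
      have h := ht₀ (t - t₁) (le_tsub_of_add_le_right ht) (ht₁ t₁ le_rfl hx)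
      rwa [← S.map_add, tsub_add_cancel_of_le (le_add_self.trans ht)] at h
    -- Failure of attraction gives orbit points at times tending to infinity outside the
    -- `η`-neighbourhood, yet a subsequence converges to a point of the ω-limit set.
    by_contra! hcon
    have hcon' : ∀ k : ℕ, ∃ t : ℝ≥0, (k : ℝ≥0) ≤ t ∧ ∃ b ∈ B,
        S t b ∉ Metric.thickening η (omegaLimit atTop (fun t u => S t u) B) := by
      intro k
      obtain ⟨t, ht, hm⟩ := hcon k
      simp only [MapsTo, not_forall] at hm
      obtain ⟨b, hb, hb'⟩ := hm
      exact ⟨t, ht, b, hb, hb'⟩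
    choose t ht b hb hn using hcon'
    have htt := tendsto_atTop_of_natCast_le ht
    obtain ⟨x, φ, hφ, hx⟩ := hac t b htt hb
    have hxm := mem_omegaLimit_of_tendsto (htt.comp hφ.tendsto_atTop) (fun k => hb (φ k)) hx
    have h := hx.eventually
      (Metric.isOpen_thickening.mem_nhds (Metric.self_subset_thickening hη _ hxm))
    obtain ⟨k, hk⟩ := h.exists
    exact hn (φ k) hk

/-- `Y = S(t) Y` lies in every neighbourhood `Metric.thickening η A`, and `A` is closed. -/
theorem IsGlobalAttractor.subset_of_isFunctionalInvariant (hA : IsGlobalAttractor S A)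
    {Y : Set X} (hb : Bornology.IsBounded Y) (hY : IsFunctionalInvariant S Y) : Y ⊆ A := by
  intro y hy
  rw [← hA.compact.isClosed.closure_eq, Metric.closure_eq_iInter_thickening, mem_iInter₂]
  intro η hη
  obtain ⟨t, ht⟩ := hA.attracts Y hb η hη
  rw [← hY t] at hy
  obtain ⟨z, hz, rfl⟩ := hy
  exact ht t le_rfl hz

theorem IsGlobalAttractor.subset_of_isBoundedAbsorbing (hA : IsGlobalAttractor S A)
    (hB : IsBoundedAbsorbing S B) : A ⊆ B := by
  obtain ⟨t, ht⟩ := hB.absorbs A hA.compact.isBounded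
  rw [← hA.invariant t]
  exact (ht t le_rfl).image_subset

theorem IsGlobalAttractor.eq_omegaLimit (hA : IsGlobalAttractor S A)
    (hB : IsBoundedAbsorbing S B) : A = omegaLimit atTop (fun t u => S t u) B := by
  apply Subset.antisymm
  · intro a ha
    rw [mem_omegaLimit_iff_frequently]
    refine fun n hn => Eventually.frequently (Eventually.of_forall fun t => ?_)
    -- Invariance gives `a` a preimage in `A ⊆ B` at every time `t`, so `a` itself is an orbit point
    -- at arbitrarily late times.
    obtain ⟨b, hb, rfl⟩ := (hA.invariant t).ge ha
    exact ⟨b, hA.subset_of_isBoundedAbsorbing hB hb, show S t b ∈ n from mem_of_mem_nhds hn⟩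
  · intro x hx
    rw [← hA.compact.isClosed.closure_eq, Metric.closure_eq_iInter_cthickening, mem_iInter₂]
    intro η hη
    obtain ⟨t₀, ht₀⟩ := hA.attracts B hB.bounded η hη
    refine closure_minimal ?_ Metric.isClosed_cthickening
      (omegaLimit_subset_closure_image2 _ _ _ (Ici_mem_atTop t₀) hx)
    rintro _ ⟨t, ht, b, hb, rfl⟩
    exact Metric.thickening_subset_cthickening _ _ (ht₀ t ht hb)

theorem IsGlobalAttractor.nonempty [Nonempty X] (hA : IsGlobalAttractor S A) : A.Nonempty := by
  obtain ⟨x⟩ := ‹Nonempty X›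
  obtain ⟨t, ht⟩ := hA.attracts {x} Bornology.isBounded_singleton 1 one_pos
  obtain ⟨a, ha, -⟩ := Metric.mem_thickening_iff.1 (ht t le_rfl (mem_singleton x))
  exact ⟨a, ha⟩

/-- A global attractor contained in a bounded connected set is connected. -/
theorem IsGlobalAttractor.isPreconnected (hA : IsGlobalAttractor S A) {C : Set X}
    (hb : Bornology.IsBounded C) (hC : IsPreconnected C) (hAC : A ⊆ C) : IsPreconnected A := by
  rw [isPreconnected_iff_subset_of_fully_disjoint_closed hA.compact.isClosed]
  intro u v hu hv huv hd
  obtain ⟨η, hη, hdis⟩ := (hd.mono (inter_subset_right (s := A))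
    (inter_subset_right (s := A))).exists_thickenings (hA.compact.inter_right hu)
    (hA.compact.isClosed.inter hv)
  -- The connected set `S(t) C` contains `A = S(t) A` and, for large `t`, lies in the union of two
  -- disjoint open neighbourhoods of the pieces, hence in one of them.
  have hAu : A = (A ∩ u) ∪ (A ∩ v) := by
    rw [← inter_union_distrib_left, inter_eq_left.2 huv]
  obtain ⟨t, ht⟩ := hA.attracts C hb η hη
  have hsub : S t '' C ⊆ Metric.thickening η (A ∩ u) ∪ Metric.thickening η (A ∩ v) := by
    rw [← Metric.thickening_union, ← hAu]
    exact (ht t le_rfl).image_subset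
  have hAS : A ⊆ S t '' C := by
    conv_lhs => rw [← hA.invariant t]
    exact image_mono hAC
  have hpre := hC.image (S t) (S.continuous_toFun t).continuousOn
  rcases hpre.subset_or_subset Metric.isOpen_thickening Metric.isOpen_thickening hdis hsub
    with h | h
  · left
    intro a ha
    refine (huv ha).resolve_right fun hav => disjoint_left.1 hdis (h (hAS ha)) ?_
    exact Metric.self_subset_thickening hη _ ⟨ha, hav⟩
  · right
    intro a ha
    refine (huv ha).resolve_left fun hau => disjoint_left.1 hdis ?_ (h (hAS ha))
    exact Metric.self_subset_thickening hη _ ⟨ha, hau⟩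

end Attractor

/-! ### Global semiflows of locally Lipschitz vector fields with a priori bounds -/

section SemiflowODE

variable {E : Type*} [NormedAddCommGroup E] [NormedSpace ℝ E] {V : E → E}

theorem IsIntegralCurveOn.hasDerivWithinAt_Ici {v : ℝ → E} {a b t : ℝ}
    (hv : IsIntegralCurveOn v (fun _ => V) (Icc a b)) (ht : t ∈ Ico a b) :
    HasDerivWithinAt v (V (v t)) (Ici t) t :=
  (hv t (Ico_subset_Icc_self ht)).mono_of_mem_nhdsWithin <|
    mem_of_superset (Icc_mem_nhdsGE ht.2) (Icc_subset_Icc_left ht.1)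

theorem IsIntegralCurveOn.dist_le {v z : ℝ → E} {K : ℝ≥0} {s : Set E} {T : ℝ}
    (hV : LipschitzOnWith K V s)
    (hv : IsIntegralCurveOn v (fun _ => V) (Icc 0 T)) (hvs : ∀ t ∈ Icc 0 T, v t ∈ s)
    (hz : IsIntegralCurveOn z (fun _ => V) (Icc 0 T)) (hzs : ∀ t ∈ Icc 0 T, z t ∈ s) :
    ∀ t ∈ Icc 0 T, dist (v t) (z t) ≤ dist (v 0) (z 0) * Real.exp (K * t) := by
  intro t ht
  have h := dist_le_of_trajectories_ODE_of_mem (v := fun _ => V) (s := fun _ => s)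
    (fun _ _ => hV) hv.continuousOn
    (fun t ht => hv.hasDerivWithinAt_Ici ht) (fun t ht => hvs t (Ico_subset_Icc_self ht))
    hz.continuousOn (fun t ht => hz.hasDerivWithinAt_Ici ht)
    (fun t ht => hzs t (Ico_subset_Icc_self ht)) le_rfl t ht
  simpa using h

/-- Concatenation of two integral curves. -/
theorem IsIntegralCurveOn.concat {v z : ℝ → E} {a b : ℝ} (ha : 0 ≤ a) (hb : 0 ≤ b)
    (hv : IsIntegralCurveOn v (fun _ => V) (Icc 0 a))
    (hz : IsIntegralCurveOn z (fun _ => V) (Icc 0 b)) (hvz : z 0 = v a) :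
    IsIntegralCurveOn (fun t => if t ≤ a then v t else z (t - a)) (fun _ => V)
      (Icc 0 (a + b)) := by
  set c : ℝ → E := fun t => if t ≤ a then v t else z (t - a) with hc
  have hc1 : ∀ t ∈ Icc 0 a, c t = v t := fun t ht => if_pos ht.2
  have hc2 : ∀ t ∈ Icc a (a + b), c t = z (t - a) := by
    intro t ht
    rcases ht.1.eq_or_lt with h | h
    · subst h
      simp [hc, hvz]
    · exact if_neg h.not_ge
  have hz' : ∀ t ∈ Icc a (a + b),
      HasDerivWithinAt (fun t => z (t - a)) (V (z (t - a))) (Icc a (a + b)) t := by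
    intro t ht
    have h := (hz (t - a) ⟨by linarith [ht.1], by linarith [ht.2]⟩).scomp t
      (h := fun t => t - a) (s := Icc a (a + b)) ((hasDerivWithinAt_id t _).sub_const a)
      (fun x hx => ⟨by linarith [hx.1], by linarith [hx.2]⟩)
    simpa [Function.comp_def] using h
  have h1 : ∀ t ∈ Icc 0 a, HasDerivWithinAt c (V (c t)) (Icc 0 a) t := fun t ht => by
    rw [hc1 t ht]
    exact (hv t ht).congr hc1 (hc1 t ht)
  have h2 : ∀ t ∈ Icc a (a + b), HasDerivWithinAt c (V (c t)) (Icc a (a + b)) t := fun t ht => by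
    rw [hc2 t ht]
    exact (hz' t ht).congr hc2 (hc2 t ht)
  intro t ht
  rcases lt_trichotomy t a with h | h | h
  · exact (h1 t ⟨ht.1, h.le⟩).mono_of_mem_nhdsWithin <|
      mem_nhdsWithin.2 ⟨Iio a, isOpen_Iio, h, fun s hs => ⟨hs.2.1, le_of_lt hs.1⟩⟩
  · rw [← Icc_union_Icc_eq_Icc ha (le_add_of_nonneg_right hb)]
    exact (h1 t ⟨ht.1, h.le⟩).union (h2 t ⟨h.ge, ht.2⟩)
  · exact (h2 t ⟨h.le, ht.2⟩).mono_of_mem_nhdsWithin <|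
      mem_nhdsWithin.2 ⟨Ioi a, isOpen_Ioi, h, fun s hs => ⟨le_of_lt hs.1, hs.2.2⟩⟩

/-- With `‖V‖ ≤ L` on the ball of radius `R + 1`, a curve starting in the ball of radius `R` needs
time at least `1/L` to travel distance 1. Thus one existence time serves all these starting points.
-/
theorem exists_isIntegralCurveOn_of_norm_le [CompleteSpace E]
    (hV : ∀ R : ℝ, ∃ K : ℝ≥0, LipschitzOnWith K V (Metric.closedBall 0 R)) {R : ℝ} (hR : 0 ≤ R) :
    ∃ τ > 0, ∀ x, ‖x‖ ≤ R → ∃ v : ℝ → E, v 0 = x ∧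
      IsIntegralCurveOn v (fun _ => V) (Icc 0 τ) := by
  obtain ⟨K, hK⟩ := hV (R + 1)
  have hbd : ∃ L : ℝ≥0, 0 < L ∧ ∀ y ∈ Metric.closedBall (0 : E) (R + 1), ‖V y‖ ≤ L := by
    refine ⟨‖V 0‖₊ + K * ⟨R + 1, by positivity⟩ + 1, by positivity, fun y hy => ?_⟩
    have h0 : (0 : E) ∈ Metric.closedBall (0 : E) (R + 1) :=
      Metric.mem_closedBall_self (by positivity)
    have h := hK.dist_le_mul y hy 0 h0
    have hy' : ‖y‖ ≤ R + 1 := by simpa using hy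
    rw [dist_eq_norm, dist_zero_right] at h
    have h1 : ‖V y‖ ≤ ‖V y - V 0‖ + ‖V 0‖ := by
      simpa using norm_add_le (V y - V 0) (V 0)
    have h2 : (K : ℝ) * ‖y‖ ≤ K * (R + 1) := by gcongr
    push_cast
    change ‖V y‖ ≤ ‖V 0‖ + K * (R + 1) + 1
    linarith
  obtain ⟨L, hL, hbd⟩ := hbd
  have hL' : (0 : ℝ) < L := hL
  refine ⟨1 / L, by positivity, fun x hx => ?_⟩
  have hsub : Metric.closedBall x ((1 : ℝ≥0) : ℝ) ⊆ Metric.closedBall 0 (R + 1) := by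
    refine Metric.closedBall_subset_closedBall' ?_
    rw [dist_zero_right]
    push_cast
    linarith
  have hpl : IsPicardLindelof (fun _ => V)
      (⟨0, le_rfl, by positivity⟩ : Icc (0 : ℝ) (1 / L)) x 1 0 L K :=
    .of_time_independent (fun y hy => hbd y (hsub hy)) (hK.mono hsub) (by
      simp [hL'.ne'])
  exact hpl.exists_eq_forall_mem_Icc_hasDerivWithinAt₀

/-- A priori bounds on integral curves starting in a ball. -/
def HasAPrioriBounds (V : E → E) : Prop :=
  ∀ R : ℝ, ∃ M : ℝ, ∀ T : ℝ, ∀ v : ℝ → E, IsIntegralCurveOn v (fun _ => V) (Icc 0 T) →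
    ‖v 0‖ ≤ R → ∀ t ∈ Icc 0 T, ‖v t‖ ≤ M

theorem exists_isIntegralCurveOn_Icc [CompleteSpace E]
    (hV : ∀ R : ℝ, ∃ K : ℝ≥0, LipschitzOnWith K V (Metric.closedBall 0 R))
    (hM : HasAPrioriBounds V) (x : E) (T : ℝ) :
    ∃ v : ℝ → E, v 0 = x ∧ IsIntegralCurveOn v (fun _ => V) (Icc 0 T) := by
  obtain ⟨M, hM⟩ := hM ‖x‖
  obtain ⟨τ, hτ, hloc⟩ := exists_isIntegralCurveOn_of_norm_le hV ((norm_nonneg x).trans (le_max_right M ‖x‖))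
  -- `M` does not depend on the length of the interval, so each endpoint stays in the ball for which
  -- `τ` works and the same step can be repeated indefinitely.
  have key : ∀ N : ℕ, ∃ v : ℝ → E, v 0 = x ∧
      IsIntegralCurveOn v (fun _ => V) (Icc 0 (N * τ)) := by
    intro N
    induction N with
    | zero =>
      obtain ⟨v, hv0, hv⟩ := hloc x (le_max_right _ _)
      exact ⟨v, hv0, hv.mono (Icc_subset_Icc_right (by simpa using hτ.le))⟩
    | succ N ih =>
      obtain ⟨v, hv0, hv⟩ := ih
      have hN : 0 ≤ N * τ := by positivity
      obtain ⟨z, hz0, hz⟩ := hloc (v (N * τ))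
        ((hM _ v hv (by rw [hv0]) _ (right_mem_Icc.2 hN)).trans (le_max_left _ _))
      refine ⟨_, ?_, (by push_cast; ring : ((N + 1 : ℕ) : ℝ) * τ = N * τ + τ) ▸
        hv.concat hN hτ.le hz hz0⟩
      simp [hN, hv0]
  obtain ⟨N, hN⟩ := exists_nat_ge (T / τ)
  obtain ⟨v, hv0, hv⟩ := key N
  exact ⟨v, hv0, hv.mono (Icc_subset_Icc_right ((div_le_iff₀ hτ).1 hN))⟩

theorem IsIntegralCurveOn.eqOn_of_hasAPrioriBounds
    (hV : ∀ R : ℝ, ∃ K : ℝ≥0, LipschitzOnWith K V (Metric.closedBall 0 R))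
    (hM : HasAPrioriBounds V) {v z : ℝ → E} {T : ℝ}
    (hv : IsIntegralCurveOn v (fun _ => V) (Icc 0 T))
    (hz : IsIntegralCurveOn z (fun _ => V) (Icc 0 T)) (h0 : v 0 = z 0) :
    EqOn v z (Icc 0 T) := by
  obtain ⟨M, hM⟩ := hM ‖v 0‖
  obtain ⟨K, hK⟩ := hV M
  intro t ht
  have h := IsIntegralCurveOn.dist_le hK hv
    (fun s hs => by simpa using hM T v hv le_rfl s hs) hz
    (fun s hs => by simpa using hM T z hz (by rw [h0]) s hs) t ht
  rw [h0, dist_self, zero_mul] at h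
  exact dist_le_zero.1 h

/-- A vector field which is Lipschitz on bounded sets and has a priori bounds generates a
continuous semigroup. -/
theorem exists_flow_of_hasAPrioriBounds [CompleteSpace E]
    (hV : ∀ R : ℝ, ∃ K : ℝ≥0, LipschitzOnWith K V (Metric.closedBall 0 R))
    (hM : HasAPrioriBounds V) :
    ∃ S : Flow ℝ≥0 E, ∀ x,
      IsIntegralCurveOn (fun t => S t.toNNReal x) (fun _ => V) (Ici 0) ∧
      ∀ T : ℝ, ∀ v : ℝ → E, IsIntegralCurveOn v (fun _ => V) (Icc 0 T) → v 0 = x →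
        ∀ t ∈ Icc 0 T, v t = S t.toNNReal x := by
  -- The curves `v x T` are unrelated choices for different `T`. Uniqueness makes them agree on
  -- overlaps, so the diagonal `t ↦ v x t t` is a single global curve.
  choose v hv0 hv using exists_isIntegralCurveOn_Icc hV hM
  have huniq : ∀ x T z, IsIntegralCurveOn z (fun _ => V) (Icc 0 T) → z 0 = x →
      ∀ t ∈ Icc 0 T, z t = v x t t := by
    intro x T z hz hz0 t ht
    exact (hz.mono (Icc_subset_Icc_right ht.2)).eqOn_of_hasAPrioriBounds hV hM (hv x t)
      (by rw [hz0, hv0]) ⟨ht.1, le_rfl⟩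
  have hcurve : ∀ x T, IsIntegralCurveOn (fun t => v x t t) (fun _ => V) (Icc 0 T) := by
    intro x T t ht
    have h : ∀ s ∈ Icc 0 T, v x s s = v x T s :=
      fun s hs => (huniq x T _ (hv x T) (hv0 x T) s hs).symm
    simpa only [h t ht] using (hv x T t ht).congr h (h t ht)
  have hglob : ∀ x, IsIntegralCurveOn (fun t => v x t t) (fun _ => V) (Ici 0) := by
    intro x t ht
    exact (hcurve x (t + 1) t ⟨ht, by linarith⟩).mono_of_mem_nhdsWithin <|
      mem_nhdsWithin.2 ⟨Iio (t + 1), isOpen_Iio, by simp, fun s hs => ⟨hs.2, hs.1.le⟩⟩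
  refine ⟨⟨fun t x => v x t t, ?_, ?_, ?_⟩, fun x => ⟨?_, ?_⟩⟩
  -- Joint continuity: the map is continuous in `t` for fixed `x`, and Lipschitz in `x` uniformly
  -- for `t ≤ t₀ + 1`, since all curves from the unit ball about `x₀` stay in one ball up to that
  -- time.
  · rw [continuous_iff_continuousAt]
    rintro ⟨t₀, x₀⟩
    obtain ⟨M, hM'⟩ := hM (‖x₀‖ + 1)
    obtain ⟨K, hK⟩ := hV M
    have hball : ∀ x ∈ Metric.closedBall x₀ 1, ‖x‖ ≤ ‖x₀‖ + 1 := fun x hx => by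
      rw [mem_closedBall_iff_norm] at hx
      have := norm_add_le (x - x₀) x₀
      simp only [sub_add_cancel] at this
      linarith
    have hmem : ∀ x ∈ Metric.closedBall x₀ 1, ∀ t ∈ Icc 0 ((t₀ : ℝ) + 1),
        v x t t ∈ Metric.closedBall (0 : E) M := fun x hx t ht => by
      rw [mem_closedBall_zero_iff]
      exact hM' _ _ (hcurve x (t₀ + 1)) (by rw [hv0]; exact hball x hx) t ht
    have hcont := continuousOn_prod_of_continuousOn_lipschitzOnWith'
      (fun p : ℝ≥0 × E => v p.2 p.1 p.1) (s := Iic (t₀ + 1)) (t := Metric.closedBall x₀ 1)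
      (Real.toNNReal (Real.exp (K * (t₀ + 1))))
      (fun t ht => LipschitzOnWith.of_dist_le_mul fun x hx y hy => by
        have ht' : (t : ℝ) ≤ t₀ + 1 := by exact_mod_cast ht
        have h := IsIntegralCurveOn.dist_le hK (hcurve x (t₀ + 1)) (hmem x hx)
          (hcurve y (t₀ + 1)) (hmem y hy) t ⟨t.2, ht'⟩
        simp only [hv0] at h
        rw [Real.coe_toNNReal _ (Real.exp_nonneg _), mul_comm]
        refine h.trans ?_
        gcongr)
      (fun x _ => ((hglob x).continuousOn.comp_continuous NNReal.continuous_coe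
        fun t => t.2).continuousOn)
    exact hcont.continuousAt (prod_mem_nhds (Iic_mem_nhds (by simp))
      (Metric.closedBall_mem_nhds x₀ one_pos))
  · intro t₁ t₂ x
    have hshift : IsIntegralCurveOn (fun t : ℝ => v x (t + t₂) (t + t₂)) (fun _ => V)
        (Icc 0 (t₁ : ℝ)) := by
      intro t ht
      have h := (hcurve x (t₁ + t₂) (t + t₂) ⟨add_nonneg ht.1 t₂.2, by linarith [ht.2]⟩).scomp t
        (h := fun t => t + (t₂ : ℝ)) (s := Icc 0 (t₁ : ℝ))
        ((hasDerivWithinAt_id t _).add_const _)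
        (fun s hs => ⟨add_nonneg hs.1 t₂.2, by linarith [hs.2]⟩)
      simpa [Function.comp_def] using h
    have h := huniq (v x t₂ t₂) t₁ _ hshift (by simp) t₁ ⟨t₁.2, le_rfl⟩
    simpa using h
  · intro x
    simpa using hv0 x 0
  · have h : ∀ t ∈ Ici (0 : ℝ), v x t.toNNReal t.toNNReal = v x t t := fun t ht => by
      rw [Real.coe_toNNReal t ht]
    intro t ht
    have h' := (hglob x t ht).congr h (h t ht)
    simpa only [h t ht] using h'
  · intro T z hz hz0 t ht
    rw [huniq x T z hz hz0 t ht]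
    simp only [Real.coe_toNNReal t ht.1]

end SemiflowODE

/-! ### Functional analysis in the weighted space -/

namespace WeightedL2

variable {w : ℤ → {r : ℝ // 0 < r}}

theorem sub_apply (u v : WeightedL2 w) (n : ℤ) : (u - v) n = u n - v n := rfl

theorem norm_sq_eq (u : WeightedL2 w) : ‖u‖ ^ 2 = ∑' n, (w n : ℝ) * ‖u n‖ ^ 2 := by
  rw [norm_def, Real.sq_sqrt (tsum_nonneg fun n => mul_nonneg (w n).2.le (sq_nonneg _))]

theorem weight_mul_sq_nonneg (u : WeightedL2 w) (n : ℤ) : 0 ≤ (w n : ℝ) * ‖u n‖ ^ 2 :=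
  mul_nonneg (w n).2.le (sq_nonneg _)

theorem weight_mul_sq_le (u : WeightedL2 w) (n : ℤ) : (w n : ℝ) * ‖u n‖ ^ 2 ≤ ‖u‖ ^ 2 := by
  rw [norm_sq_eq]
  exact u.summable.le_tsum n fun m _ => u.weight_mul_sq_nonneg m

theorem norm_apply_le (hw : ∀ n, 1 ≤ (w n : ℝ)) (u : WeightedL2 w) (n : ℤ) : ‖u n‖ ≤ ‖u‖ := by
  refine le_of_sq_le_sq ?_ (norm_nonneg _)
  exact (le_mul_of_one_le_left (sq_nonneg _) (hw n)).trans (u.weight_mul_sq_le n)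

theorem summable_weight_mul_sq_of_le {x : ℤ → ℂ} {C : ℝ} (u : WeightedL2 w)
    (h : ∀ n, ‖x n‖ ≤ C * ‖u n‖) : Summable fun n => (w n : ℝ) * ‖x n‖ ^ 2 := by
  refine .of_nonneg_of_le (fun n => mul_nonneg (w n).2.le (sq_nonneg _)) (fun n => ?_)
    (u.summable.mul_left (C ^ 2))
  calc (w n : ℝ) * ‖x n‖ ^ 2 ≤ w n * (C * ‖u n‖) ^ 2 := by
        have := (w n).2.le
        gcongr
        exact h n
    _ = C ^ 2 * (w n * ‖u n‖ ^ 2) := by ring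

theorem norm_le_mul_norm {C : ℝ} (hC : 0 ≤ C) {x u : WeightedL2 w}
    (h : ∀ n, ‖x n‖ ≤ C * ‖u n‖) : ‖x‖ ≤ C * ‖u‖ := by
  refine le_of_sq_le_sq ?_ (by positivity)
  rw [mul_pow, norm_sq_eq, norm_sq_eq, ← tsum_mul_left]
  refine x.summable.tsum_le_tsum (fun n => ?_) (u.summable.mul_left _)
  calc (w n : ℝ) * ‖x n‖ ^ 2 ≤ w n * (C * ‖u n‖) ^ 2 := by
        have := (w n).2.le
        gcongr
        exact h n
    _ = C ^ 2 * (w n * ‖u n‖ ^ 2) := by ring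

/-- Translation by `k` is bounded when the weight is comparable to its translate. -/
theorem exists_translate {k : ℤ} {C : ℝ} (hC : ∀ n, (w n : ℝ) ≤ C * w (n + k))
    (u : WeightedL2 w) : ∃ s : WeightedL2 w, (∀ n, s n = u (n + k)) ∧ ‖s‖ ≤ √C * ‖u‖ := by
  have hsum : Summable fun n => C * ((w (n + k) : ℝ) * ‖u (n + k)‖ ^ 2) :=
    ((Equiv.addRight k).summable_iff.2 u.summable).mul_left C
  have hle : ∀ n, (w n : ℝ) * ‖u (n + k)‖ ^ 2 ≤ C * (w (n + k) * ‖u (n + k)‖ ^ 2) := fun n => by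
    rw [← mul_assoc]
    gcongr
    exact hC n
  have hs : Summable fun n => (w n : ℝ) * ‖u (n + k)‖ ^ 2 :=
    .of_nonneg_of_le (fun n => mul_nonneg (w n).2.le (sq_nonneg _)) hle hsum
  obtain ⟨s, hs'⟩ : ∃ s : WeightedL2 w, ∀ n, s n = u (n + k) := ⟨⟨_, hs⟩, fun _ => rfl⟩
  refine ⟨s, hs', ?_⟩
  have hC0 : 0 ≤ C := by
    have h := (w 0).2.trans_le (hC 0)
    exact (pos_of_mul_pos_left h (w (0 + k)).2.le).le
  refine le_of_sq_le_sq ?_ (by positivity)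
  rw [mul_pow, Real.sq_sqrt hC0, norm_sq_eq, norm_sq_eq]
  simp only [hs']
  calc ∑' n, (w n : ℝ) * ‖u (n + k)‖ ^ 2
      ≤ ∑' n, C * ((w (n + k) : ℝ) * ‖u (n + k)‖ ^ 2) := hs.tsum_le_tsum hle hsum
    _ = C * ∑' n, (w n : ℝ) * ‖u n‖ ^ 2 := by
        rw [tsum_mul_left]
        exact congrArg (C * ·) ((Equiv.addRight k).tsum_eq fun n => (w n : ℝ) * ‖u n‖ ^ 2)

/-- Multiplication by a sequence `a` with `a² ≤ w`, as a map into the unweighted space. -/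
def toLp2 (a : ℤ → ℝ) (ha : ∀ n, a n ^ 2 ≤ w n) :
    WeightedL2 w →L[ℝ] lp (fun _ : ℤ => ℂ) 2 :=
  LinearMap.mkContinuous
    { toFun := fun u => ⟨fun n => (a n : ℂ) * u n, by
        refine memℓp_gen (.of_nonneg_of_le (fun n => by positivity) (fun n => ?_) u.summable)
        have h : ‖(a n : ℂ) * u n‖ ^ (2 : ENNReal).toReal = a n ^ 2 * ‖u n‖ ^ 2 := by
          simp [mul_pow]
        rw [h]
        gcongr
        exact ha n⟩
      map_add' := fun u v => by
        ext n
        exact mul_add _ _ _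
      map_smul' := fun c u => by
        ext n
        exact mul_left_comm _ _ _ }
    1 fun u => by
      rw [one_mul]
      refine le_of_sq_le_sq ?_ (norm_nonneg _)
      have h := lp.norm_rpow_eq_tsum (p := 2) (E := fun _ : ℤ => ℂ) (by norm_num)
        ⟨fun n => (a n : ℂ) * u n, by
          refine memℓp_gen (.of_nonneg_of_le (fun n => by positivity) (fun n => ?_) u.summable)
          have h : ‖(a n : ℂ) * u n‖ ^ (2 : ENNReal).toReal = a n ^ 2 * ‖u n‖ ^ 2 := by
            simp [mul_pow]
          rw [h]
          gcongr
          exact ha n⟩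
      have hle : ∀ n, a n ^ 2 * ‖u n‖ ^ 2 ≤ w n * ‖u n‖ ^ 2 := fun n => by
        gcongr
        exact ha n
      simp only [ENNReal.toReal_ofNat, Real.rpow_ofNat, norm_mul, Complex.norm_real,
        Real.norm_eq_abs, mul_pow, sq_abs] at h
      rw [norm_sq_eq]
      refine h.le.trans (Summable.tsum_le_tsum hle ?_ u.summable)
      exact .of_nonneg_of_le (fun n => by positivity) hle u.summable

theorem toLp2_apply (a : ℤ → ℝ) (ha : ∀ n, a n ^ 2 ≤ w n) (u : WeightedL2 w) (n : ℤ) :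
    toLp2 a ha u n = a n * u n := rfl

theorem hasSum_inner_toLp2 (a : ℤ → ℝ) (ha : ∀ n, a n ^ 2 ≤ w n) (u v : WeightedL2 w) :
    HasSum (fun n => a n ^ 2 * inner ℝ (u n) (v n)) (inner ℝ (toLp2 a ha u) (toLp2 a ha v)) := by
  convert! lp.hasSum_inner (𝕜 := ℝ) (toLp2 a ha u) (toLp2 a ha v) using 2 with n
  simp only [toLp2_apply, Complex.inner, map_mul, Complex.conj_ofReal, Complex.mul_re,
    Complex.mul_im, Complex.ofReal_re, Complex.ofReal_im, Complex.conj_re, Complex.conj_im]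
  ring

theorem norm_toLp2_sq (a : ℤ → ℝ) (ha : ∀ n, a n ^ 2 ≤ w n) (u : WeightedL2 w) :
    ‖toLp2 a ha u‖ ^ 2 = ∑' n, a n ^ 2 * ‖u n‖ ^ 2 := by
  rw [← real_inner_self_eq_norm_sq, ← (hasSum_inner_toLp2 a ha u u).tsum_eq]
  simp only [real_inner_self_eq_norm_sq]

/-- Multiplication by `√w` is an isometry onto the unweighted `ℓ²`. -/
instance : CompleteSpace (WeightedL2 w) := by
  have ha : ∀ n, √(w n : ℝ) ^ 2 ≤ w n := fun n => (Real.sq_sqrt (w n).2.le).le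
  have hiso : Isometry (toLp2 (fun n => √(w n : ℝ)) ha) := by
    refine AddMonoidHomClass.isometry_of_norm _ fun u => ?_
    refine (sq_eq_sq₀ (norm_nonneg _) (norm_nonneg _)).1 ?_
    rw [norm_toLp2_sq, norm_sq_eq]
    simp only [Real.sq_sqrt (w _).2.le]
  have hsurj : Function.Surjective (toLp2 (fun n => √(w n : ℝ)) ha) := by
    intro y
    have hy := (lp.memℓp y).summable (by norm_num)
    simp only [ENNReal.toReal_ofNat, Real.rpow_ofNat] at hy
    have hw : ∀ n, √(w n : ℝ) ≠ 0 := fun n => (Real.sqrt_pos.2 (w n).2).ne'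
    have hs : Summable fun n => (w n : ℝ) * ‖(((√(w n : ℝ))⁻¹ : ℝ) : ℂ) * y n‖ ^ 2 := by
      refine hy.congr fun n => ?_
      rw [norm_mul, mul_pow, Complex.norm_real, Real.norm_eq_abs, sq_abs, inv_pow,
        Real.sq_sqrt (w n).2.le, mul_inv_cancel_left₀ (w n).2.ne']
    refine ⟨⟨_, hs⟩, ?_⟩
    · ext n
      change ((√(w n : ℝ) : ℝ) : ℂ) * ((((√(w n : ℝ))⁻¹ : ℝ) : ℂ) * y n) = y n
      rw [← mul_assoc, ← Complex.ofReal_mul, mul_inv_cancel₀ (hw n), Complex.ofReal_one, one_mul]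
  exact ((IsometryEquiv.mk (Equiv.ofBijective _ ⟨hiso.injective, hsurj⟩) hiso).completeSpace_iff).2
    inferInstance

theorem summable_mul_inner {p : ℤ → ℝ} (hp : ∀ n, 0 ≤ p n) (hpw : ∀ n, p n ≤ w n)
    (u v : WeightedL2 w) : Summable fun n => p n * inner ℝ (u n) (v n) := by
  have ha : ∀ n, √(p n) ^ 2 ≤ w n := fun n => by rw [Real.sq_sqrt (hp n)]; exact hpw n
  simpa only [Real.sq_sqrt (hp _)] using (hasSum_inner_toLp2 (fun n => √(p n)) ha u v).summable

/-- Multiplication by `√p` is bounded and linear into a Hilbert space, so the chain rule for the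
squared norm replaces termwise differentiation of the series. -/
theorem hasDerivWithinAt_tsum_mul_norm_sq {p : ℤ → ℝ} (hp : ∀ n, 0 ≤ p n)
    (hpw : ∀ n, p n ≤ w n) {v : ℝ → WeightedL2 w} {v' : WeightedL2 w} {s : Set ℝ} {t : ℝ}
    (hv : HasDerivWithinAt v v' s t) :
    HasDerivWithinAt (fun t => ∑' n, p n * ‖v t n‖ ^ 2)
      (2 * ∑' n, p n * inner ℝ (v t n) (v' n)) s t := by
  have ha : ∀ n, √(p n) ^ 2 ≤ w n := fun n => by rw [Real.sq_sqrt (hp n)]; exact hpw n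
  have h := ((toLp2 (fun n => √(p n)) ha).hasFDerivAt.comp_hasDerivWithinAt t hv).norm_sq
  have h1 : (fun x => ‖(⇑(toLp2 (fun n => √(p n)) ha) ∘ v) x‖ ^ 2) =
      fun t => ∑' n, p n * ‖v t n‖ ^ 2 := by
    funext t
    rw [Function.comp_apply, norm_toLp2_sq]
    simp only [Real.sq_sqrt (hp _)]
  have h2 := (hasSum_inner_toLp2 (fun n => √(p n)) ha (v t) v').tsum_eq
  simp only [Real.sq_sqrt (hp _)] at h2
  rw [h2]
  rw [h1] at h
  exact h

/-- Splitting off finitely many coordinates in the distance. -/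
theorem norm_sub_sq_le (s : Finset ℤ) (u v : WeightedL2 w) :
    ‖u - v‖ ^ 2 ≤ ∑ n ∈ s, (w n : ℝ) * ‖u n - v n‖ ^ 2
      + 2 * (‖u‖ ^ 2 - ∑ n ∈ s, (w n : ℝ) * ‖u n‖ ^ 2)
      + 2 * (‖v‖ ^ 2 - ∑ n ∈ s, (w n : ℝ) * ‖v n‖ ^ 2) := by
  have hsplit : ∀ x : WeightedL2 w, ‖x‖ ^ 2 = ∑ n ∈ s, (w n : ℝ) * ‖x n‖ ^ 2
      + ∑' n : {n // n ∉ s}, (w n : ℝ) * ‖x n‖ ^ 2 := fun x => by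
    rw [norm_sq_eq]
    exact (x.summable.sum_add_tsum_subtype_compl s).symm
  have hsub : ∀ x : WeightedL2 w, Summable fun n : {n // n ∉ s} => (w n : ℝ) * ‖x n‖ ^ 2 :=
    fun x => x.summable.subtype _
  rw [hsplit (u - v), hsplit u, hsplit v, add_sub_cancel_left, add_sub_cancel_left, add_assoc,
    ← tsum_mul_left, ← tsum_mul_left,
    ← ((hsub u).mul_left 2).tsum_add ((hsub v).mul_left 2)]
  refine add_le_add le_rfl ((hsub (u - v)).tsum_le_tsum (fun n => ?_)
    (((hsub u).mul_left 2).add ((hsub v).mul_left 2)))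
  have h1 : ‖u n - v n‖ ≤ ‖u n‖ + ‖v n‖ := norm_sub_le _ _
  have h2 : ‖u n - v n‖ ^ 2 ≤ 2 * ‖u n‖ ^ 2 + 2 * ‖v n‖ ^ 2 := by
    nlinarith [norm_nonneg (u n - v n), sq_nonneg (‖u n‖ - ‖v n‖)]
  have h3 := mul_le_mul_of_nonneg_left h2 (w n).2.le
  rw [sub_apply]
  linarith

/-- A bounded sequence with uniformly small tails has a convergent subsequence. -/
theorem exists_tendsto_subseq_of_tails (hw : ∀ n, 1 ≤ (w n : ℝ)) {x : ℕ → WeightedL2 w} {M : ℝ}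
    (hM : ∀ k, ‖x k‖ ≤ M)
    (htail : ∀ η > 0, ∃ s : Finset ℤ, ∀ᶠ k in atTop,
      ‖x k‖ ^ 2 - ∑ n ∈ s, (w n : ℝ) * ‖x k n‖ ^ 2 ≤ η) :
    ∃ y, ∃ φ : ℕ → ℕ, StrictMono φ ∧ Tendsto (x ∘ φ) atTop (𝓝 y) := by
  have hK : IsCompact (univ.pi fun _ : ℤ => Metric.closedBall (0 : ℂ) M) :=
    isCompact_univ_pi fun _ => isCompact_closedBall _ _
  obtain ⟨z, -, φ, hφ, hz⟩ := hK.isSeqCompact (x := fun k n => x k n) (fun k n _ => by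
    rw [mem_closedBall_zero_iff]
    exact ((x k).norm_apply_le hw n).trans (hM k))
  have hcauchy : CauchySeq (x ∘ φ) := by
    rw [Metric.cauchySeq_iff]
    intro ε hε
    -- Two tails, each with factor 2 in `norm_sub_sq_le`, add up to `ε²/2`. The finite part supplies
    -- the other half.
    obtain ⟨s, hs⟩ := htail (ε ^ 2 / 8) (by positivity)
    have hlim : Tendsto (fun p : ℕ × ℕ => ∑ n ∈ s, (w n : ℝ) * ‖x (φ p.1) n - x (φ p.2) n‖ ^ 2)
        atTop (𝓝 0) := by
      have h : ∀ n ∈ s, Tendsto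
          (fun p : ℕ × ℕ => (w n : ℝ) * ‖x (φ p.1) n - x (φ p.2) n‖ ^ 2) atTop (𝓝 0) := by
        intro n _
        have hn := tendsto_pi_nhds.1 hz n
        rw [← prod_atTop_atTop_eq]
        have h1 := (hn.comp tendsto_fst).sub (hn.comp (tendsto_snd (f := atTop (α := ℕ))))
        simpa using (h1.norm.pow 2).const_mul (w n : ℝ)
      simpa using tendsto_finsetSum s h
    have hev := (hlim.eventually_lt_const (show (0 : ℝ) < ε ^ 2 / 2 by positivity))
    obtain ⟨N₁, hN₁⟩ := eventually_atTop_prod_self.1 hev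
    obtain ⟨N₂, hN₂⟩ := eventually_atTop.1 (hφ.tendsto_atTop.eventually hs)
    refine ⟨max N₁ N₂, fun i hi j hj => ?_⟩
    rw [dist_eq_norm]
    refine lt_of_pow_lt_pow_left₀ 2 hε.le ?_
    have h := norm_sub_sq_le s (x (φ i)) (x (φ j))
    have h1 := hN₁ i j (le_of_max_le_left hi) (le_of_max_le_left hj)
    have h2 := hN₂ i (le_of_max_le_right hi)
    have h3 := hN₂ j (le_of_max_le_right hj)
    simp only [Function.comp_apply]
    simp only at h1
    linarith
  obtain ⟨y, hy⟩ := cauchySeq_tendsto_of_complete hcauchy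
  exact ⟨y, φ, hφ, hy⟩

end WeightedL2

/-! ### The weight and the nonlinearity -/

namespace WeightCondition

variable {w : ℤ → {r : ℝ // 0 < r}} {d₁ d₂ : ℝ}

theorem d₁_nonneg (hw : WeightCondition w d₁ d₂) : 0 ≤ d₁ :=
  nonneg_of_mul_nonneg_left ((abs_nonneg _).trans (hw.abs_sub_le 0)) (w 0).2

theorem succ_le (hw : WeightCondition w d₁ d₂) (n : ℤ) :
    (w (n + 1) : ℝ) ≤ (1 + d₁) * w n := by
  linarith [(abs_le.1 (hw.abs_sub_le n)).2]

theorem le_mul_succ (hw : WeightCondition w d₁ d₂) (n : ℤ) :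
    (w n : ℝ) ≤ d₂⁻¹ * w (n + 1) := by
  rw [inv_mul_eq_div, le_div_iff₀ hw.d₂_pos, mul_comm]
  exact hw.le_succ n

theorem le_mul_pred (hw : WeightCondition w d₁ d₂) (n : ℤ) :
    (w n : ℝ) ≤ (1 + d₁) * w (n + -1) := by
  simpa using hw.succ_le (n + -1)

/-- `w_n a b ≤ d₂^{-1/2} (w_n a² + w_{n+1} b²) / 2`. -/
theorem mul_mul_le (hw : WeightCondition w d₁ d₂) (n : ℤ) (a b : ℝ) :
    w n * (a * b) ≤ d₂ ^ (-(1 / 2) : ℝ) * ((w n * a ^ 2 + w (n + 1) * b ^ 2) / 2) := by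
  set q := d₂ ^ (-(1 / 2) : ℝ) with hq
  have hq0 : 0 < q := Real.rpow_pos_of_pos hw.d₂_pos _
  have hqd : q ^ 2 = d₂⁻¹ := by
    rw [hq, ← Real.rpow_natCast, ← Real.rpow_mul hw.d₂_pos.le, ← Real.rpow_neg_one]
    norm_num
  have h1 : (w n : ℝ) ≤ q ^ 2 * w (n + 1) := hqd ▸ hw.le_mul_succ n
  have h2 : (w n : ℝ) * b ^ 2 ≤ q ^ 2 * w (n + 1) * b ^ 2 := by gcongr
  -- The balance between `a` and `b` is chosen so that `w_n b² ≤ q² w_{n+1} b²` puts the same factor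
  -- `q²` on both squares. One `q` then cancels.
  have h3 : 0 ≤ (w n : ℝ) * (q * a - b) ^ 2 := mul_nonneg (w n).2.le (sq_nonneg _)
  have h4 : q * (w n * (a * b)) ≤
      q * (q * ((w n * a ^ 2 + w (n + 1) * b ^ 2) / 2)) := by linarith
  exact le_of_mul_le_mul_left h4 hq0

/-- A crude companion of `mul_mul_le`, for summability and for terms that carry a factor `ε`, where
the size of the constant is irrelevant. -/
theorem succ_mul_mul_le (hw : WeightCondition w d₁ d₂) (n : ℤ) (a b : ℝ) :
    w (n + 1) * (a * b) ≤ (1 + d₁) / 2 * (w n * a ^ 2 + w (n + 1) * b ^ 2) := by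
  have h1 : (w (n + 1) : ℝ) * a ^ 2 ≤ (1 + d₁) * w n * a ^ 2 := by
    gcongr
    exact hw.succ_le n
  have h2 : 0 ≤ (w (n + 1) : ℝ) * (a - b) ^ 2 := mul_nonneg (w _).2.le (sq_nonneg _)
  have h3 : 0 ≤ d₁ * ((w (n + 1) : ℝ) * b ^ 2) :=
    mul_nonneg hw.d₁_nonneg (mul_nonneg (w _).2.le (sq_nonneg _))
  linarith

end WeightCondition

namespace NonlinearityCondition

variable {F : ℂ → ℂ}

theorem map_zero (hF : NonlinearityCondition F) : F 0 = 0 := by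
  obtain ⟨f, -, -, hf⟩ := hF
  simp [hf]

theorem contDiff (hF : NonlinearityCondition F) : ContDiff ℝ 1 F := by
  obtain ⟨f, hd, hc, hf⟩ := hF
  have h : ContDiff ℝ 1 f := contDiff_one_iff_deriv.2 ⟨hd, hc⟩
  rw [funext hf]
  exact (Complex.ofRealCLM.contDiff.comp (h.comp (contDiff_norm_sq ℝ))).mul contDiff_id

theorem exists_lipschitzOnWith (hF : NonlinearityCondition F) (R : ℝ) :
    ∃ K : ℝ≥0, LipschitzOnWith K F (Metric.closedBall 0 R) :=
  LocallyLipschitzOn.exists_lipschitzOnWith_of_compact (isCompact_closedBall _ _)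
    hF.contDiff.locallyLipschitz.locallyLipschitzOn

/-- Since `f` is real, `z̄ · i f(|z|²) z` is purely imaginary. This is why no growth or sign
condition on `f` is needed. -/
theorem inner_I_mul (hF : NonlinearityCondition F) (z : ℂ) :
    inner ℝ z (Complex.I * F z) = 0 := by
  obtain ⟨f, -, -, hf⟩ := hF
  simp only [hf, Complex.inner, Complex.mul_re, Complex.mul_im, Complex.conj_re,
    Complex.conj_im, Complex.I_re, Complex.I_im, Complex.ofReal_re, Complex.ofReal_im]
  ring

end NonlinearityCondition

/-! ### The vector field of the lattice equation -/

section Field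

variable {w : ℤ → {r : ℝ // 0 < r}} {d₁ d₂ δ : ℝ} {F : ℂ → ℂ} {g : WeightedL2 w}

/-- `V` is the vector field of the lattice equation written as `u̇ = V(u)`. -/
def IsDNLSField (δ : ℝ) (F : ℂ → ℂ) (g : WeightedL2 w) (V : WeightedL2 w → WeightedL2 w) : Prop :=
  ∀ (u : WeightedL2 w) (n : ℤ), V u n = Complex.I * (u (n - 1) - 2 * u n + u (n + 1))
    - δ * u n + Complex.I * F (u n) - Complex.I * g n

theorem eq_field_iff {a b c d u' : ℂ} :
    Complex.I * u' + a + Complex.I * (δ : ℂ) * b + c = d ↔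
      u' = Complex.I * a - δ * b + Complex.I * c - Complex.I * d := by
  constructor
  · rintro rfl
    linear_combination (u' + δ * b) * Complex.I_sq
  · rintro rfl
    linear_combination (a + c - d) * Complex.I_sq

theorem exists_isDNLSField (hw : WeightCondition w d₁ d₂) (hF : NonlinearityCondition F)
    (g : WeightedL2 w) : ∃ V : WeightedL2 w → WeightedL2 w, IsDNLSField δ F g V := by
  suffices h : ∀ u : WeightedL2 w, ∃ v : WeightedL2 w, ∀ n : ℤ,
      v n = Complex.I * (u (n - 1) - 2 * u n + u (n + 1))
        - δ * u n + Complex.I * F (u n) - Complex.I * g n by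
    choose V hV using h
    exact ⟨V, hV⟩
  intro u
  obtain ⟨p, hp, -⟩ := u.exists_translate hw.le_mul_succ
  obtain ⟨m, hm, -⟩ := u.exists_translate hw.le_mul_pred
  obtain ⟨K, hK⟩ := hF.exists_lipschitzOnWith ‖u‖
  obtain ⟨q, hq⟩ : ∃ q : WeightedL2 w, ∀ n, q n = F (u n) :=
    ⟨⟨fun n => F (u n), u.summable_weight_mul_sq_of_le (C := K) fun n => by
      have h := hK.dist_le_mul (u n) (by simpa using u.norm_apply_le hw.one_le n) 0
        (Metric.mem_closedBall_self (norm_nonneg u))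
      simpa [hF.map_zero] using h⟩, fun _ => rfl⟩
  refine ⟨Complex.I • (m - (2 : ℂ) • u + p) - (δ : ℂ) • u + Complex.I • q - Complex.I • g,
    fun n => ?_⟩
  simp only [WeightedL2.add_apply, WeightedL2.sub_apply, WeightedL2.smul_apply, hp, hm, hq,
    ← sub_eq_add_neg]

theorem IsDNLSField.exists_lipschitzOnWith {V : WeightedL2 w → WeightedL2 w}
    (hV : IsDNLSField δ F g V) (hw : WeightCondition w d₁ d₂) (hF : NonlinearityCondition F)
    (R : ℝ) : ∃ K : ℝ≥0, LipschitzOnWith K V (Metric.closedBall 0 R) := by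
  obtain ⟨K, hK⟩ := hF.exists_lipschitzOnWith R
  refine ⟨⟨√d₂⁻¹ + √(1 + d₁) + ‖2 * Complex.I + δ‖ + K, by positivity⟩,
    LipschitzOnWith.of_dist_le_mul fun u hu v hv => ?_⟩
  rw [mem_closedBall_zero_iff] at hu hv
  rw [dist_eq_norm, dist_eq_norm]
  obtain ⟨p, hp, hpn⟩ := (u - v).exists_translate hw.le_mul_succ
  obtain ⟨m, hm, hmn⟩ := (u - v).exists_translate hw.le_mul_pred
  have hle : ∀ n, ‖F (u n) - F (v n)‖ ≤ K * ‖(u - v) n‖ := fun n => by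
    have h := hK.dist_le_mul (u n) (by simpa using (u.norm_apply_le hw.one_le n).trans hu) (v n)
      (by simpa using (v.norm_apply_le hw.one_le n).trans hv)
    rwa [dist_eq_norm, dist_eq_norm] at h
  obtain ⟨q, hq⟩ : ∃ q : WeightedL2 w, ∀ n, q n = F (u n) - F (v n) :=
    ⟨⟨_, (u - v).summable_weight_mul_sq_of_le hle⟩, fun _ => rfl⟩
  have hqn : ‖q‖ ≤ K * ‖u - v‖ :=
    WeightedL2.norm_le_mul_norm K.2 fun n => by rw [hq]; exact hle n
  have heq : V u - V v = Complex.I • p + Complex.I • m - (2 * Complex.I + (δ : ℂ)) • (u - v)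
      + Complex.I • q := by
    refine WeightedL2.ext fun n => ?_
    simp only [WeightedL2.add_apply, WeightedL2.sub_apply, WeightedL2.smul_apply, hp, hm, hq,
      hV u n, hV v n, ← sub_eq_add_neg]
    ring
  rw [heq]
  calc _ ≤ ‖p‖ + ‖m‖ + ‖2 * Complex.I + (δ : ℂ)‖ * ‖u - v‖ + ‖q‖ := by
        refine (norm_add_le _ _).trans (add_le_add ((norm_sub_le _ _).trans
          (add_le_add ((norm_add_le _ _).trans ?_) ?_)) ?_) <;> simp [norm_smul]
    _ ≤ √d₂⁻¹ * ‖u - v‖ + √(1 + d₁) * ‖u - v‖ + ‖2 * Complex.I + (δ : ℂ)‖ * ‖u - v‖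
          + K * ‖u - v‖ := by gcongr
    _ = _ := by
        change _ = (√d₂⁻¹ + √(1 + d₁) + ‖2 * Complex.I + (δ : ℂ)‖ + K) * ‖u - v‖
        ring

theorem continuous_of_lipschitzOnWith_closedBall {E E' : Type*} [NormedAddCommGroup E]
    [PseudoMetricSpace E'] {V : E → E'}
    (hV : ∀ R : ℝ, ∃ K : ℝ≥0, LipschitzOnWith K V (Metric.closedBall 0 R)) : Continuous V := by
  rw [continuous_iff_continuousAt]
  intro x
  obtain ⟨K, hK⟩ := hV (‖x‖ + 1)
  refine hK.continuousOn.continuousAt (mem_of_superset (Metric.ball_mem_nhds x one_pos) ?_)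
  intro y hy
  rw [mem_ball_iff_norm] at hy
  rw [mem_closedBall_zero_iff]
  have := norm_add_le (y - x) x
  simp only [sub_add_cancel] at this
  linarith

theorem IsDNLSField.isIntegralCurveOn {V : WeightedL2 w → WeightedL2 w}
    (hV : IsDNLSField δ F g V) {J : Set ℝ} {v : ℝ → WeightedL2 w}
    (hv : IsDNLSSolutionOn δ F g J v) : IsIntegralCurveOn v (fun _ => V) J := by
  obtain ⟨v', -, h⟩ := hv
  intro t ht
  have heq : v' t = V (v t) := WeightedL2.ext fun n => by
    rw [hV]
    exact eq_field_iff.1 ((h t ht).2 n)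
  have h' := (h t ht).1
  rwa [heq] at h'

theorem IsDNLSField.isDNLSSolutionOn {V : WeightedL2 w → WeightedL2 w}
    (hV : IsDNLSField δ F g V) (hVc : Continuous V) {J : Set ℝ} {v : ℝ → WeightedL2 w}
    (hv : IsIntegralCurveOn v (fun _ => V) J) : IsDNLSSolutionOn δ F g J v :=
  ⟨fun t => V (v t), hVc.comp_continuousOn hv.continuousOn, fun t ht =>
    ⟨hv t ht, fun n => eq_field_iff.2 (hV (v t) n)⟩⟩

end Field

/-! ### Energy estimates -/

section Energy

variable {w : ℤ → {r : ℝ // 0 < r}} {d₁ d₂ δ : ℝ} {F : ℂ → ℂ} {g : WeightedL2 w}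

/-- A cut-off function with values in `[0, 1]` and increments at most `ε`. -/
structure IsCutoff (χ : ℤ → ℝ) (ε : ℝ) : Prop where
  nonneg : ∀ n, 0 ≤ χ n
  le_one : ∀ n, χ n ≤ 1
  abs_sub_le : ∀ n, |χ (n + 1) - χ n| ≤ ε

theorem IsCutoff.mul_nonneg {χ : ℤ → ℝ} {ε : ℝ} (hχ : IsCutoff χ ε) (n : ℤ) :
    0 ≤ χ n * w n :=
  _root_.mul_nonneg (hχ.nonneg n) (w n).2.le

theorem IsCutoff.mul_le {χ : ℤ → ℝ} {ε : ℝ} (hχ : IsCutoff χ ε) (n : ℤ) :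
    χ n * w n ≤ w n :=
  mul_le_of_le_one_left (w n).2.le (hχ.le_one n)

theorem IsCutoff.summable {χ : ℤ → ℝ} {ε : ℝ} (hχ : IsCutoff χ ε) (u : WeightedL2 w) :
    Summable fun n => χ n * w n * ‖u n‖ ^ 2 :=
  .of_nonneg_of_le (fun n => _root_.mul_nonneg (hχ.mul_nonneg n) (sq_nonneg _))
    (fun n => mul_le_mul_of_nonneg_right (hχ.mul_le n) (sq_nonneg _)) u.summable

theorem IsCutoff.tsum_le {χ : ℤ → ℝ} {ε : ℝ} (hχ : IsCutoff χ ε) (u : WeightedL2 w) :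
    ∑' n, χ n * w n * ‖u n‖ ^ 2 ≤ ‖u‖ ^ 2 := by
  rw [WeightedL2.norm_sq_eq]
  exact (hχ.summable u).tsum_le_tsum
    (fun n => mul_le_mul_of_nonneg_right (hχ.mul_le n) (sq_nonneg _)) u.summable

/-- The discrete product rule splits the increment of `χ w` into `χ_n (w_{n+1} - w_n)`, controlled
by `d₁`, and `(χ_{n+1} - χ_n) w_{n+1}`, controlled by `ε`. Replacing `χ_n` by `χ_{n+1}` in front of
`b²` costs another `ε`. -/
theorem abs_cross_term_le (hw : WeightCondition w d₁ d₂) {χ : ℤ → ℝ} {ε : ℝ}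
    (hχ : IsCutoff χ ε) (n : ℤ) {a b : ℝ} (ha : 0 ≤ a) (hb : 0 ≤ b) :
    |χ (n + 1) * w (n + 1) - χ n * w n| * (a * b) ≤
      d₁ * d₂ ^ (-(1 / 2) : ℝ) / 2 * (χ n * w n * a ^ 2
          + χ (n + 1) * w (n + 1) * b ^ 2 + ε * (w (n + 1) * b ^ 2))
        + (1 + d₁) / 2 * ε * (w n * a ^ 2 + w (n + 1) * b ^ 2) := by
  have hD : 0 ≤ d₁ * d₂ ^ (-(1 / 2) : ℝ) :=
    mul_nonneg hw.d₁_nonneg (Real.rpow_pos_of_pos hw.d₂_pos _).le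
  have hε : 0 ≤ ε := (abs_nonneg _).trans (hχ.abs_sub_le n)
  have hχn := hχ.nonneg n
  have h1 : |χ (n + 1) * w (n + 1) - χ n * w n| ≤ d₁ * (χ n * w n) + ε * w (n + 1) := by
    have h : χ (n + 1) * w (n + 1) - χ n * w n =
        χ n * (w (n + 1) - w n) + (χ (n + 1) - χ n) * w (n + 1) := by ring
    rw [h]
    refine (abs_add_le _ _).trans (add_le_add ?_ ?_)
    · rw [abs_mul, abs_of_nonneg hχn]
      have := mul_le_mul_of_nonneg_left (hw.abs_sub_le n) hχn
      linarith
    · rw [abs_mul, abs_of_pos (w (n + 1)).2]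
      exact mul_le_mul_of_nonneg_right (hχ.abs_sub_le n) (w (n + 1)).2.le
  have hab : 0 ≤ a * b := mul_nonneg ha hb
  have h2 := mul_le_mul_of_nonneg_right h1 hab
  have h3 := mul_le_mul_of_nonneg_left (hw.mul_mul_le n a b) (mul_nonneg hw.d₁_nonneg hχn)
  have h4 := mul_le_mul_of_nonneg_left (hw.succ_mul_mul_le n a b) hε
  have h5 : χ n * (w (n + 1) * b ^ 2) ≤ χ (n + 1) * w (n + 1) * b ^ 2
      + ε * (w (n + 1) * b ^ 2) := by
    have h := mul_le_mul_of_nonneg_right (abs_le.1 (hχ.abs_sub_le n)).1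
      (mul_nonneg (w (n + 1)).2.le (sq_nonneg b))
    linarith
  have h6 := mul_le_mul_of_nonneg_left h5 (div_nonneg hD zero_le_two)
  linarith

/-- The energy balance with a cut-off. -/
theorem IsDNLSField.two_mul_tsum_inner_le {V : WeightedL2 w → WeightedL2 w}
    (hV : IsDNLSField δ F g V) (hw : WeightCondition w d₁ d₂) (hF : NonlinearityCondition F)
    (hδ : 0 < δ) (hdamp : 0 ≤ δ / 2 - 2 * d₁ * d₂ ^ (-(1 / 2) : ℝ))
    {χ : ℤ → ℝ} {ε : ℝ} (hχ : IsCutoff χ ε) (u : WeightedL2 w) :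
    2 * ∑' n, χ n * w n * inner ℝ (u n) (V u n) ≤
      -δ * ∑' n, χ n * w n * ‖u n‖ ^ 2
        + (d₁ * d₂ ^ (-(1 / 2) : ℝ) + 2 * (1 + d₁)) * (ε * ‖u‖ ^ 2)
        + 2 / δ * ∑' n, χ n * w n * ‖g n‖ ^ 2 := by
  set D := d₁ * d₂ ^ (-(1 / 2) : ℝ) with hD
  have hDδ : 4 * D ≤ δ := by rw [hD]; linarith
  set p : ℤ → ℝ := fun n => χ n * w n with hp
  set c : ℤ → ℝ := fun n => inner ℝ (u n) (Complex.I * u (n + 1)) with hc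
  have hc_abs : ∀ n, |c n| ≤ ‖u n‖ * ‖u (n + 1)‖ := fun n => by
    have h := abs_real_inner_le_norm (u n) (Complex.I * u (n + 1))
    rwa [norm_mul, Complex.norm_I, one_mul] at h
  have hshift : ∀ {f : ℤ → ℝ} {s : ℝ}, HasSum f s → HasSum (fun n => f (n + 1)) s :=
    fun h => (Equiv.addRight (1 : ℤ)).hasSum_iff.2 h
  have hE : HasSum (fun n => (w n : ℝ) * ‖u n‖ ^ 2) (‖u‖ ^ 2) := by
    rw [WeightedL2.norm_sq_eq]
    exact u.summable.hasSum
  have hy := (hχ.summable u).hasSum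
  have hG := (hχ.summable g).hasSum
  have hf : Summable fun n => p (n + 1) * c n := by
    refine .of_norm_bounded (hE.add (hshift hE)|>.mul_left ((1 + d₁) / 2)).summable fun n => ?_
    rw [norm_mul, Real.norm_eq_abs, Real.norm_eq_abs, abs_of_nonneg (hχ.mul_nonneg (n + 1))]
    refine le_trans ?_ (hw.succ_mul_mul_le n ‖u n‖ ‖u (n + 1)‖)
    exact mul_le_mul (hχ.mul_le _) (hc_abs n) (abs_nonneg _) (w _).2.le
  -- Summation by parts: both flux series have the same sum, so their difference contributes
  -- nothing.
  have hf' : HasSum (fun n => p n * c (n - 1)) (∑' n, p (n + 1) * c n) := by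
    refine (Equiv.addRight (1 : ℤ)).hasSum_iff.1 ?_
    simpa [Function.comp_def] using hf.hasSum
  have hT := (WeightedL2.summable_mul_inner hχ.mul_nonneg hχ.mul_le u (V u)).hasSum
  -- Budget for the damping `δ`: the forcing takes `δ/4`, leaving `3δ/4`. The cross term takes `D ≤
  -- δ/4`. The remaining `δ/2` becomes the rate `δ` after doubling.
  have hB := (((((hy.add (hshift hy)).add ((hshift hE).mul_left ε)).mul_left (D / 2)).add
    ((hE.add (hshift hE)).mul_left ((1 + d₁) / 2 * ε))).add
    (hy.mul_left (-(3 / 4) * δ))).add (hG.mul_left (1 / δ))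
  have hle := hasSum_le (fun n => ?_) hT ((hf.hasSum.sub hf').add hB)
  · have hy0 : 0 ≤ ∑' n, χ n * w n * ‖u n‖ ^ 2 :=
      tsum_nonneg fun n => mul_nonneg (hχ.mul_nonneg n) (sq_nonneg _)
    have := mul_le_mul_of_nonneg_right hDδ hy0
    have h2 : 2 / δ * ∑' n, χ n * w n * ‖g n‖ ^ 2 =
      2 * (1 / δ * ∑' n, χ n * w n * ‖g n‖ ^ 2) := by ring
    rw [h2]
    linarith
  -- Multiplication by `i` is skew for the real inner product: the diagonal term `-2i u_n` vanishes
  -- and the neighbour terms form a flux difference.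
  · have hin : inner ℝ (u n) (V u n) = c n - c (n - 1) - δ * ‖u n‖ ^ 2
        - inner ℝ (u n) (Complex.I * g n) := by
      have h0 := hF.inner_I_mul (u n)
      rw [hV, hc]
      simp only [inner_sub_right, inner_add_right, mul_add, mul_sub, h0, sub_add_cancel]
      have h1 : inner ℝ (u n) ((δ : ℂ) * u n) = δ * ‖u n‖ ^ 2 := by
        rw [← Complex.real_smul, real_inner_smul_right, real_inner_self_eq_norm_sq]
      have h2 : inner ℝ (u n) (Complex.I * (2 * u n)) = 0 := by
        simp only [Complex.inner, Complex.mul_re, Complex.mul_im, Complex.conj_re,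
          Complex.conj_im, Complex.I_re, Complex.I_im, Complex.re_ofNat, Complex.im_ofNat]
        ring
      have h3 : inner ℝ (u n) (Complex.I * u (n - 1)) =
          -inner ℝ (u (n - 1)) (Complex.I * u n) := by
        simp only [Complex.inner, Complex.mul_re, Complex.mul_im, Complex.conj_re,
          Complex.conj_im, Complex.I_re, Complex.I_im]
        ring
      rw [h1, h2, h3]
      ring
    have hg : -inner ℝ (u n) (Complex.I * g n) ≤ 1 / δ * ‖g n‖ ^ 2 + δ / 4 * ‖u n‖ ^ 2 := by
      have h := (abs_le.1 (abs_real_inner_le_norm (u n) (Complex.I * g n))).1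
      rw [norm_mul, Complex.norm_I, one_mul] at h
      have h1 : 0 ≤ 1 / δ * (‖g n‖ - δ / 2 * ‖u n‖) ^ 2 := by positivity
      have h2 : 1 / δ * (‖g n‖ - δ / 2 * ‖u n‖) ^ 2 =
          1 / δ * ‖g n‖ ^ 2 + δ / 4 * ‖u n‖ ^ 2 - ‖u n‖ * ‖g n‖ := by
        field_simp
        ring
      linarith
    have hcross := abs_cross_term_le hw hχ n (norm_nonneg (u n)) (norm_nonneg (u (n + 1)))
    have hcr : (p n - p (n + 1)) * c n ≤
        |χ (n + 1) * w (n + 1) - χ n * w n| * (‖u n‖ * ‖u (n + 1)‖) := by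
      refine (le_abs_self _).trans ?_
      rw [abs_mul, abs_sub_comm]
      exact mul_le_mul_of_nonneg_left (hc_abs n) (abs_nonneg _)
    have hpg := mul_le_mul_of_nonneg_left hg (hχ.mul_nonneg (w := w) n)
    have hfin : p n * inner ℝ (u n) (V u n) = (p n - p (n + 1)) * c n
        + (p (n + 1) * c n - p n * c (n - 1)) - δ * (p n * ‖u n‖ ^ 2)
        + p n * -inner ℝ (u n) (Complex.I * g n) := by
      rw [hin]
      ring
    change p n * inner ℝ (u n) (V u n) ≤ _
    rw [hfin]
    simp only [hp] at *
    linarith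

theorem le_exp_mul_add_of_deriv_le {y y' : ℝ → ℝ} {A T : ℝ} (hδ : 0 < δ) (hA : 0 ≤ A)
    (hy : ∀ t ∈ Icc 0 T, HasDerivWithinAt y (y' t) (Icc 0 T) t)
    (hy' : ∀ t ∈ Icc 0 T, y' t ≤ -δ * y t + A) :
    ∀ t ∈ Icc 0 T, y t ≤ Real.exp (-δ * t) * y 0 + A / δ := by
  intro t ht
  have h := le_gronwallBound_of_liminf_deriv_right_le (f := y) (f' := y') (δ := y 0) (K := -δ)
    (ε := A) (a := 0) (b := T) (fun t ht => (hy t ht).continuousWithinAt)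
    (fun t ht r hr => ((hy t (Ico_subset_Icc_self ht)).mono_of_mem_nhdsWithin
      (mem_of_superset (Icc_mem_nhdsGE ht.2) (Icc_subset_Icc_left ht.1))
      |>.liminf_right_slope_le hr)) le_rfl
    (fun t ht => hy' t (Ico_subset_Icc_self ht)) t ht
  rw [gronwallBound_of_K_ne_0 (neg_ne_zero.2 hδ.ne'), sub_zero] at h
  have h1 : A / -δ * (Real.exp (-δ * t) - 1) = A / δ - A / δ * Real.exp (-δ * t) := by
    rw [div_neg]
    ring
  have h2 : 0 ≤ A / δ * Real.exp (-δ * t) := by positivity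
  linarith

/-- The bound `M` on the cut-off error is an input. With `ε = 0` it is free and yields the a priori
bound, which then supplies `M` for genuine cut-offs. -/
theorem IsDNLSField.energy_le {V : WeightedL2 w → WeightedL2 w}
    (hV : IsDNLSField δ F g V) (hw : WeightCondition w d₁ d₂) (hF : NonlinearityCondition F)
    (hδ : 0 < δ) (hdamp : 0 ≤ δ / 2 - 2 * d₁ * d₂ ^ (-(1 / 2) : ℝ))
    {χ : ℤ → ℝ} {ε M T : ℝ} (hχ : IsCutoff χ ε) {v : ℝ → WeightedL2 w}
    (hv : IsIntegralCurveOn v (fun _ => V) (Icc 0 T))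
    (hM : ∀ t ∈ Icc 0 T, ε * ‖v t‖ ^ 2 ≤ M) (hM0 : 0 ≤ M) :
    ∀ t ∈ Icc 0 T, ∑' n, χ n * w n * ‖v t n‖ ^ 2 ≤
      Real.exp (-δ * t) * ‖v 0‖ ^ 2
        + ((d₁ * d₂ ^ (-(1 / 2) : ℝ) + 2 * (1 + d₁)) * M
          + 2 / δ * ∑' n, χ n * w n * ‖g n‖ ^ 2) / δ := by
  intro t ht
  have hD : 0 ≤ d₁ * d₂ ^ (-(1 / 2) : ℝ) + 2 * (1 + d₁) := by
    have h1 := hw.d₁_nonneg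
    have h2 := (Real.rpow_pos_of_pos hw.d₂_pos (-(1 / 2))).le
    positivity
  have hG : 0 ≤ ∑' n, χ n * w n * ‖g n‖ ^ 2 :=
    tsum_nonneg fun n => mul_nonneg (hχ.mul_nonneg n) (sq_nonneg _)
  have h := le_exp_mul_add_of_deriv_le (δ := δ)
    (A := (d₁ * d₂ ^ (-(1 / 2) : ℝ) + 2 * (1 + d₁)) * M
      + 2 / δ * ∑' n, χ n * w n * ‖g n‖ ^ 2) hδ (by positivity)
    (fun t ht => WeightedL2.hasDerivWithinAt_tsum_mul_norm_sq hχ.mul_nonneg hχ.mul_le (hv t ht))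
    (fun t ht => (hV.two_mul_tsum_inner_le hw hF hδ hdamp hχ (v t)).trans
      (by
        rw [add_assoc]
        gcongr
        exact hM t ht)) t ht
  refine h.trans ?_
  gcongr
  exact hχ.tsum_le (v 0)

theorem isCutoff_one : IsCutoff (fun _ => 1) 0 :=
  ⟨fun _ => zero_le_one, fun _ => le_rfl, fun _ => by simp⟩

theorem IsDNLSField.norm_sq_le {V : WeightedL2 w → WeightedL2 w}
    (hV : IsDNLSField δ F g V) (hw : WeightCondition w d₁ d₂) (hF : NonlinearityCondition F)
    (hδ : 0 < δ) (hdamp : 0 ≤ δ / 2 - 2 * d₁ * d₂ ^ (-(1 / 2) : ℝ)) {T : ℝ}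
    {v : ℝ → WeightedL2 w} (hv : IsIntegralCurveOn v (fun _ => V) (Icc 0 T)) :
    ∀ t ∈ Icc 0 T, ‖v t‖ ^ 2 ≤
      Real.exp (-δ * t) * ‖v 0‖ ^ 2 + 2 / δ ^ 2 * ‖g‖ ^ 2 := by
  intro t ht
  have h := hV.energy_le hw hF hδ hdamp isCutoff_one hv (M := 0) (by simp) le_rfl t ht
  simp only [one_mul, ← WeightedL2.norm_sq_eq, mul_zero, zero_add] at h
  refine h.trans (le_of_eq ?_)
  field_simp

theorem IsDNLSField.hasAPrioriBounds {V : WeightedL2 w → WeightedL2 w}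
    (hV : IsDNLSField δ F g V) (hw : WeightCondition w d₁ d₂) (hF : NonlinearityCondition F)
    (hδ : 0 < δ) (hdamp : 0 ≤ δ / 2 - 2 * d₁ * d₂ ^ (-(1 / 2) : ℝ)) : HasAPrioriBounds V := by
  intro R
  refine ⟨√(R ^ 2 + 2 / δ ^ 2 * ‖g‖ ^ 2), fun T v hv hR t ht => Real.le_sqrt_of_sq_le ?_⟩
  refine (hV.norm_sq_le hw hF hδ hdamp hv t ht).trans ?_
  have h1 : Real.exp (-δ * t) ≤ 1 := Real.exp_le_one_iff.2 (by nlinarith [ht.1])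
  have h2 : ‖v 0‖ ^ 2 ≤ R ^ 2 := by gcongr
  have h3 := mul_le_of_le_one_left (sq_nonneg ‖v 0‖) h1
  linarith

/-- The cut-off `min(1, |n| / (m + 1))`. -/
def tailCutoff (m : ℕ) (n : ℤ) : ℝ := min 1 (|(n : ℝ)| / (m + 1))

theorem isCutoff_tailCutoff (m : ℕ) : IsCutoff (tailCutoff m) (1 / (m + 1)) := by
  refine ⟨fun n => le_min zero_le_one (by positivity), fun n => min_le_left _ _, fun n => ?_⟩
  refine (abs_min_sub_min_le_max _ _ _ _).trans (max_le (by simp; positivity) ?_)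
  rw [← sub_div, abs_div, abs_of_pos (show (0 : ℝ) < m + 1 by positivity)]
  gcongr
  refine (abs_abs_sub_abs_le _ _).trans ?_
  simp

theorem tailCutoff_eq_one {m : ℕ} {n : ℤ} (hn : n ∉ Finset.Icc (-(m : ℤ)) m) :
    tailCutoff m n = 1 := by
  refine min_eq_left ((one_le_div (by positivity)).2 ?_)
  have h : (m : ℤ) + 1 ≤ |n| := by
    by_contra! h
    exact hn (Finset.mem_Icc.2 (abs_le.1 (by omega)))
  exact_mod_cast h

/-- Dominated convergence: for fixed `n` the cut-off tends to 0 as `m → ∞`. -/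
theorem tendsto_tsum_tailCutoff (u : WeightedL2 w) :
    Tendsto (fun m : ℕ => ∑' n, tailCutoff m n * w n * ‖u n‖ ^ 2) atTop (𝓝 0) := by
  have h := tendsto_tsum_of_dominated_convergence (𝓕 := atTop)
    (f := fun (m : ℕ) (n : ℤ) => tailCutoff m n * w n * ‖u n‖ ^ 2) (g := fun _ => 0)
    u.summable (fun n => ?_) (Eventually.of_forall fun m n => ?_)
  · simpa using h
  · have h1 : Tendsto (fun m : ℕ => |(n : ℝ)| / (m + 1)) atTop (𝓝 0) := by
      simpa [div_eq_mul_inv] using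
        (tendsto_one_div_add_atTop_nhds_zero_nat (𝕜 := ℝ)).const_mul |(n : ℝ)|
    have h2 := ((tendsto_const_nhds (x := (1 : ℝ))).min h1).mul_const ((w n : ℝ) * ‖u n‖ ^ 2)
    simpa [tailCutoff, mul_assoc] using h2
  · have hχ := isCutoff_tailCutoff m
    rw [Real.norm_of_nonneg (mul_nonneg (hχ.mul_nonneg n) (sq_nonneg _))]
    exact mul_le_mul_of_nonneg_right (hχ.mul_le n) (sq_nonneg _)

theorem norm_sq_sub_sum_le (u : WeightedL2 w) (m : ℕ) :
    ‖u‖ ^ 2 - ∑ n ∈ Finset.Icc (-(m : ℤ)) m, (w n : ℝ) * ‖u n‖ ^ 2 ≤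
      ∑' n, tailCutoff m n * w n * ‖u n‖ ^ 2 := by
  have hχ := isCutoff_tailCutoff m
  have h1 := u.summable.sum_add_tsum_subtype_compl (Finset.Icc (-(m : ℤ)) m)
  have h2 := (hχ.summable u).sum_add_tsum_subtype_compl (Finset.Icc (-(m : ℤ)) m)
  have h3 : 0 ≤ ∑ n ∈ Finset.Icc (-(m : ℤ)) m, tailCutoff m n * w n * ‖u n‖ ^ 2 :=
    Finset.sum_nonneg fun n _ => mul_nonneg (hχ.mul_nonneg n) (sq_nonneg _)
  have h4 : ∑' n : {n // n ∉ Finset.Icc (-(m : ℤ)) m}, (w n : ℝ) * ‖u n‖ ^ 2 =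
      ∑' n : {n // n ∉ Finset.Icc (-(m : ℤ)) m}, tailCutoff m n * w n * ‖u n‖ ^ 2 :=
    tsum_congr fun n => by rw [tailCutoff_eq_one n.2, one_mul]
  rw [WeightedL2.norm_sq_eq]
  linarith

end Energy

/-! ### The global attractor of the lattice equation -/

section Semigroup

variable {w : ℤ → {r : ℝ // 0 < r}} {d₁ d₂ δ : ℝ} {F : ℂ → ℂ} {g : WeightedL2 w}
  {V : WeightedL2 w → WeightedL2 w} {S : Flow ℝ≥0 (WeightedL2 w)}

theorem isIntegralCurveOn_flow
    (hS : ∀ u, IsIntegralCurveOn (fun t => S t.toNNReal u) (fun _ => V) (Ici 0)) (u : WeightedL2 w)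
    (T : ℝ) : IsIntegralCurveOn (fun t => S t.toNNReal u) (fun _ => V) (Icc 0 T) :=
  (hS u).mono Icc_subset_Ici_self

theorem IsDNLSField.norm_flow_sq_le (hV : IsDNLSField δ F g V) (hw : WeightCondition w d₁ d₂)
    (hF : NonlinearityCondition F) (hδ : 0 < δ)
    (hdamp : 0 ≤ δ / 2 - 2 * d₁ * d₂ ^ (-(1 / 2) : ℝ))
    (hS : ∀ u, IsIntegralCurveOn (fun t => S t.toNNReal u) (fun _ => V) (Ici 0))
    (u : WeightedL2 w) (t : ℝ≥0) :
    ‖S t u‖ ^ 2 ≤ Real.exp (-δ * t) * ‖u‖ ^ 2 + 2 / δ ^ 2 * ‖g‖ ^ 2 := by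
  have h := hV.norm_sq_le hw hF hδ hdamp (isIntegralCurveOn_flow hS u t) t ⟨t.2, le_rfl⟩
  simpa [S.map_zero_apply] using h

theorem tendsto_exp_neg_mul_coe (hδ : 0 < δ) :
    Tendsto (fun t : ℝ≥0 => Real.exp (-δ * t)) atTop (𝓝 0) := by
  refine Real.tendsto_exp_atBot.comp ?_
  exact (NNReal.tendsto_coe_atTop.2 tendsto_id).const_mul_atTop_of_neg (neg_lt_zero.2 hδ)

/-- The summand 1 in the squared radius makes room for the decaying contribution of the initial
value. -/
theorem IsDNLSField.isBoundedAbsorbing_closedBall (hV : IsDNLSField δ F g V)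
    (hw : WeightCondition w d₁ d₂) (hF : NonlinearityCondition F) (hδ : 0 < δ)
    (hdamp : 0 ≤ δ / 2 - 2 * d₁ * d₂ ^ (-(1 / 2) : ℝ))
    (hS : ∀ u, IsIntegralCurveOn (fun t => S t.toNNReal u) (fun _ => V) (Ici 0)) :
    IsBoundedAbsorbing S (Metric.closedBall 0 √(1 + 2 / δ ^ 2 * ‖g‖ ^ 2)) where
  bounded := Metric.isBounded_closedBall
  absorbs := by
    intro B hB
    obtain ⟨r, hr⟩ := hB.exists_norm_le
    have h := ((tendsto_exp_neg_mul_coe hδ).mul_const (r ^ 2)).eventually_le_const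
      (show 0 * r ^ 2 < 1 by simp)
    obtain ⟨t₀, ht₀⟩ := eventually_atTop.1 h
    refine ⟨t₀, fun t ht u hu => ?_⟩
    rw [mem_closedBall_zero_iff]
    refine Real.le_sqrt_of_sq_le ((hV.norm_flow_sq_le hw hF hδ hdamp hS u t).trans ?_)
    have h1 : ‖u‖ ^ 2 ≤ r ^ 2 := by gcongr; exact hr u hu
    have h2 := mul_le_mul_of_nonneg_left h1 (Real.exp_nonneg (-δ * t))
    linarith [ht₀ t ht]

theorem IsDNLSField.isAsymptoticallyCompactOn (hV : IsDNLSField δ F g V)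
    (hw : WeightCondition w d₁ d₂) (hF : NonlinearityCondition F) (hδ : 0 < δ)
    (hdamp : 0 ≤ δ / 2 - 2 * d₁ * d₂ ^ (-(1 / 2) : ℝ))
    (hS : ∀ u, IsIntegralCurveOn (fun t => S t.toNNReal u) (fun _ => V) (Ici 0))
    {B : Set (WeightedL2 w)} (hB : Bornology.IsBounded B) : IsAsymptoticallyCompactOn S B := by
  intro t b ht hb
  obtain ⟨r, hr⟩ := hB.exists_norm_le
  obtain ⟨M, hM⟩ := hV.hasAPrioriBounds hw hF hδ hdamp r
  have hbound : ∀ k, ∀ T : ℝ, ∀ s ∈ Icc 0 T, ‖S s.toNNReal (b k)‖ ≤ M := fun k T =>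
    hM T _ (isIntegralCurveOn_flow hS (b k) T) (by
      simpa [S.map_zero_apply] using hr (b k) (hb k))
  refine WeightedL2.exists_tendsto_subseq_of_tails hw.one_le
    (x := fun k => S (t k) (b k)) (M := M) (fun k => ?_) fun η hη => ?_
  · simpa using hbound k (t k) (t k) ⟨(t k).2, le_rfl⟩
  have htail : Tendsto (fun m : ℕ =>
      ((d₁ * d₂ ^ (-(1 / 2) : ℝ) + 2 * (1 + d₁)) * (1 / ((m : ℝ) + 1) * M ^ 2)
        + 2 / δ * ∑' n, tailCutoff m n * w n * ‖g n‖ ^ 2) / δ) atTop (𝓝 0) := by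
    have h1 := (((tendsto_one_div_add_atTop_nhds_zero_nat (𝕜 := ℝ)).mul_const (M ^ 2)).const_mul
      (d₁ * d₂ ^ (-(1 / 2) : ℝ) + 2 * (1 + d₁))).add
        ((tendsto_tsum_tailCutoff g).const_mul (2 / δ))
    simpa using h1.div_const δ
  -- First fix the cut-off so that the time-independent part is at most `η/2`. Only then let the
  -- time grow until the exponential part is too.
  obtain ⟨m, hm⟩ := (htail.eventually_le_const (half_pos hη)).exists
  have hexp : Tendsto (fun k => Real.exp (-δ * t k) * r ^ 2) atTop (𝓝 0) := by
    simpa using ((tendsto_exp_neg_mul_coe hδ).comp ht).mul_const (r ^ 2)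
  refine ⟨Finset.Icc (-(m : ℤ)) m, ?_⟩
  filter_upwards [hexp.eventually_le_const (half_pos hη)] with k hk
  refine (norm_sq_sub_sum_le _ m).trans ?_
  have h := hV.energy_le hw hF hδ hdamp (isCutoff_tailCutoff m)
    (isIntegralCurveOn_flow hS (b k) (t k)) (M := 1 / ((m : ℝ) + 1) * M ^ 2)
    (fun s hs => by
      gcongr
      exact hbound k (t k) s hs) (by positivity) (t k) ⟨(t k).2, le_rfl⟩
  simp only [Real.toNNReal_coe, Real.toNNReal_zero, S.map_zero_apply] at h
  have h1 : ‖b k‖ ^ 2 ≤ r ^ 2 := by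
    gcongr
    exact hr _ (hb k)
  have h2 := mul_le_mul_of_nonneg_left h1 (Real.exp_nonneg (-δ * t k))
  linarith

end Semigroup

end

theorem theorem7p2 (w : ℤ → {r : ℝ // 0 < r}) (d₁ d₂ δ : ℝ) (F : ℂ → ℂ) (g : WeightedL2 w)
    (hw : WeightCondition w d₁ d₂) (hF : NonlinearityCondition F) (hδ : 0 < δ)
    (hdamp : 0 ≤ δ / 2 - 2 * d₁ * d₂ ^ (-(1 / 2) : ℝ)) :
    ∃ S : Flow ℝ≥0 (WeightedL2 w), IsDNLSSemigroup δ F g S ∧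
      (∃ B₀ : Set (WeightedL2 w), IsBoundedAbsorbing S B₀) ∧
      ∃ A : Set (WeightedL2 w),
        IsGlobalAttractor S A ∧ IsConnected A ∧
        (∀ B₀ : Set (WeightedL2 w), IsBoundedAbsorbing S B₀ →
          A = omegaLimit atTop (fun t u => S t u) B₀ ∧ A ⊆ B₀) ∧
        (∀ Y : Set (WeightedL2 w), Bornology.IsBounded Y → IsFunctionalInvariant S Y →
          Y ⊆ A) := by
  obtain ⟨V, hV⟩ := exists_isDNLSField (δ := δ) hw hF g
  have hlip := hV.exists_lipschitzOnWith hw hF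
  obtain ⟨S, hS⟩ := exists_flow_of_hasAPrioriBounds hlip (hV.hasAPrioriBounds hw hF hδ hdamp)
  have hcurve := fun u => (hS u).1
  have hB := hV.isBoundedAbsorbing_closedBall hw hF hδ hdamp hcurve
  have hA := hB.isGlobalAttractor_omegaLimit
    (hV.isAsymptoticallyCompactOn hw hF hδ hdamp hcurve hB.bounded)
  refine ⟨S, ⟨S.map_zero_apply, fun u => ?_, fun u T _ v hv hv0 => ?_⟩, ⟨_, hB⟩, _, hA,
    ⟨hA.nonempty, ?_⟩, fun B₀ hB₀ => ⟨hA.eq_omegaLimit hB₀, hA.subset_of_isBoundedAbsorbing hB₀⟩,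
    fun Y hY hinv => hA.subset_of_isFunctionalInvariant hY hinv⟩
  · exact hV.isDNLSSolutionOn (continuous_of_lipschitzOnWith_closedBall hlip) (hcurve u)
  · exact (hS u).2 T v (hV.isIntegralCurveOn hv) hv0
  -- Any ball containing the attractor serves as the bounded connected set, being convex.
  · obtain ⟨r, hr⟩ := hA.compact.isBounded.subset_closedBall 0
    exact hA.isPreconnected Metric.isBounded_closedBall (convex_closedBall 0 r).isPreconnected hr
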